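/- **Setting.** Let $(\mathcal D,\mathfrak B(\mathcal D),\mathbb P)$ be a metric space with its Borel $\sigma$-algebra and a probability measure, $n\ge 0$, $m\ge 1$, $c\in\mathbb R^n$. For $k=1,\dots,m$ let $\mathbb X_k\subset\mathbb R^n$ be compact and convex, and let $f_k:\mathbb X_k\times\mathcal D\to\mathbb R$ be measurable, convex in $x$ for each $d$, and bounded in $d$ for each $x$. Let $\varepsilon_k\in[0,1]$. For samples $(d_1,\dots,d_N)\in\mathcal D^N$ consider the feasible sets $$\begin{aligned} \mathrm{RCP}_k&=\{x\in\mathbb X_k: f_k(x,d)\le 0\ \ \forall d\in\mathcal D\},\\ \mathrm{CCP}_k&=\{x\in\mathbb X_k: \mathbb P[f_k(x,d)\le 0]\ge 1-\varepsilon_k\},\\ \mathrm{SCP}_k&=\{x\in\mathbb X_k: f_k(x,d_i)\le 0,\ i=1,\dots,N\}. \end{aligned}$$ Let $J^\star_{\mathrm{RP}}$, $J^\star_{\mathrm{CP}}$, $J^\star_N$ be the optimal values (infima) of $c^\top x$ over $\bigcup_k\mathrm{RCP}_k$, $\bigcup_k\mathrm{CCP}_k$, $\bigcup_k\mathrm{SCP}_k$,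 respectively. **Assumptions.** (a) For every $k$ and every $N\ge1$ the optimizer of the $k$-th scenario program $\min\{c^\top x: x\in\mathrm{SCP}_k\}$ exists and is a Borel measurable function of $(d_1,\dots,d_N)$. If the optimizer is not unique, the one meant is that which minimizes $\varphi_k$ among all optimizers, where $\varphi_k:\mathbb R^n\to\mathbb R$ is a fixed strictly convex tie-break function. (b) For every $k$ there is $x_0^{(k)}\in\mathbb X_k$ with $\sup_{d}f_k(x_0^{(k)},d)<0$. **Notation.** Let $p_k(x,\delta)=\mathbb P\big[\sup_{v}f_k(x,v)-\delta<f_k(x,d)\big]$, and let $h_k:[0,1]\to[0,\infty]$ be a uniform level-set bound, that is, $h_k(\varepsilon)\ge\sup\{\delta\ge 0:\inf_{x\in\mathbb X_k}p_k(x,\delta)\le\varepsilon\}$ for all $\varepsilon\in[0,1]$. Put $$L_k=\frac{\min_{x\in\mathbb X_k}c^\top x-c^\top x_0^{(k)}}{\sup_d f_k(x_0^{(k)},d)},\qquad R_k=\max_{x\in\mathbb X_k}c^\top x-\min_{x\in\mathbb X_k}c^\top x,$$ $$I^{(k)}(\varepsilon)=\min\{L_kh_k(\varepsilon),R_k\},\qquad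 I_N^{(k)}(\varepsilon)=\min\{\|\lambda^{(k)}_N\|_1h_k(\varepsilon),R_k\}\qquad(0\cdot\infty:=0),$$ where $\lambda^{(k)}_N=\lambda^{(k)}_N(d_1,\dots,d_N)$ is an optimizer of the Lagrange dual of the $k$-th scenario program, $\max_{\lambda\in\mathbb R^N_{\ge0}}\ \inf_{x\in\mathbb X_k}\big(c^\top x+\sum_{i=1}^N\lambda_if_k(x,d_i)\big)$. Finally let $$\widetilde N(\vec\varepsilon,\beta)=\min\Big\{N\in\mathbb N:\ \sum_{k=1}^m\sum_{i=0}^{n-1}\binom Ni\varepsilon_k^i(1-\varepsilon_k)^{N-i}\le\beta\Big\}\qquad(\min\emptyset:=\infty).$$ **Theorem.** Let $\beta\in[0,1]$ and let $N\in\mathbb N$ satisfy $N\ge\widetilde N(\vec\varepsilon,\beta)$. Then, with respect to $N$ independent samples drawn from $\mathbb P$: * A priori: $\ \mathbb P^N\big[J^\star_{\mathrm{RP}}-J^\star_N\in[0,\max_kI^{(k)}(\varepsilon_k)]\big]\ge1-\beta\ $ and $\ \mathbb P^N\big[J^\star_{\mathrm{CP}}-J^\star_N\in[-\max_kI^{(k)}(\varepsilon_k),0]\big]\ge1-\beta$.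 * A posteriori: for every choice of dual optimizers, $\ \mathbb P^N\big[J^\star_{\mathrm{CP}}-J^\star_N\in[-\max_kI_N^{(k)}(\varepsilon_k),0]\big]\ge1-\beta$. -/

import Mathlib

open MeasureTheory
open scoped ENNReal NNReal

noncomputable section

/-- Data of one convex subprogram with uncertainty space `D`: a compact convex decision set
`X ⊆ ℝⁿ` and a measurable constraint function `f : X × D → ℝ` that is convex in the decision
and, for each decision, bounded in the uncertainty.  Only the values of `f` on `X × D` are used. -/
structure UncertainProgram (n : ℕ) (D : Type*) [MeasurableSpace D] where
  X : Set (EuclideanSpace ℝ (Fin n))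
  f : EuclideanSpace ℝ (Fin n) → D → ℝ
  isCompact_X : IsCompact X
  convex_X : Convex ℝ X
  measurable_f : Measurable fun z : X × D => f z.1 z.2
  convexOn_f : ∀ d, ConvexOn ℝ X fun x => f x d
  bounded_f : ∀ x ∈ X, ∃ M : ℝ, ∀ d, |f x d| ≤ M

/-- Optimal value of `min cᵀx` over the feasible set `S`. -/
def optValue {n : ℕ} (c : EuclideanSpace ℝ (Fin n)) (S : Set (EuclideanSpace ℝ (Fin n))) : ℝ :=
  sInf ((fun x => inner ℝ c x) '' S)

namespace UncertainProgram

variable {n : ℕ} {D : Type*} [MeasurableSpace D]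

/-- Feasible set of the robust program. -/
def robust (Q : UncertainProgram n D) : Set (EuclideanSpace ℝ (Fin n)) :=
  {x | x ∈ Q.X ∧ ∀ d, Q.f x d ≤ 0}

/-- Feasible set of the chance-constrained program with violation level `ε`. -/
def chance (Q : UncertainProgram n D) (P : Measure D) (ε : ℝ) :
    Set (EuclideanSpace ℝ (Fin n)) :=
  {x | x ∈ Q.X ∧ 1 - ε ≤ P.real {d | Q.f x d ≤ 0}}

/-- Feasible set of the scenario program for the samples `d 0, …, d (N-1)`. -/
def scenario (Q : UncertainProgram n D) {N : ℕ} (d : Fin N → D) :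
    Set (EuclideanSpace ℝ (Fin n)) :=
  {x | x ∈ Q.X ∧ ∀ i, Q.f x (d i) ≤ 0}

/-- `x` is an optimizer of the scenario program, and among all its optimizers it minimizes
the tie-break function `φ`.  When the scenario program has just one optimizer, this says
that `x` is that optimizer, whatever `φ` is. -/
def IsScenarioOptimizer (Q : UncertainProgram n D) (c : EuclideanSpace ℝ (Fin n))
    (φ : EuclideanSpace ℝ (Fin n) → ℝ) {N : ℕ} (d : Fin N → D)
    (x : EuclideanSpace ℝ (Fin n)) : Prop :=
  x ∈ Q.scenario d ∧ (∀ y ∈ Q.scenario d, inner ℝ c x ≤ inner ℝ c y) ∧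
    ∀ y ∈ Q.scenario d, inner ℝ c y = inner ℝ c x → φ x ≤ φ y

/-- For every number `N ≥ 1` of samples the scenario program has an optimizer which, ties being
broken by a strictly convex function, is a Borel measurable function of the samples.  This
includes the case that the optimizer is unique (then every `φ` will do) and measurable. -/
def HasMeasurableOptimizer (Q : UncertainProgram n D) (c : EuclideanSpace ℝ (Fin n)) : Prop :=
  ∃ φ : EuclideanSpace ℝ (Fin n) → ℝ, StrictConvexOn ℝ Set.univ φ ∧
    ∀ N : ℕ, 1 ≤ N → ∃ xs : (Fin N → D) → EuclideanSpace ℝ (Fin n), Measurable xs ∧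
      ∀ d, Q.IsScenarioOptimizer c φ d (xs d)

/-- Tail probability of the worst-case violation,
`p(x, δ) = P[sup_v f(x, v) - δ < f(x, d)]`. -/
def tailProb (Q : UncertainProgram n D) (P : Measure D) (x : EuclideanSpace ℝ (Fin n))
    (δ : ℝ≥0) : ℝ≥0∞ :=
  P {d | (⨆ v, Q.f x v) - δ < Q.f x d}

/-- `h` is a uniform level-set bound: `h(ε) ≥ sup {δ ≥ 0 | inf_{x ∈ X} p(x, δ) ≤ ε}` for all
`ε ∈ [0, 1]`.  The supremum is `∞` at `ε = 1` (and may be so elsewhere), so that `h` has to be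
allowed the value `∞`. -/
def IsULB (Q : UncertainProgram n D) (P : Measure D) (h : ℝ → ℝ≥0∞) : Prop :=
  ∀ ε ∈ Set.Icc (0 : ℝ) 1,
    sSup {t : ℝ≥0∞ | ∃ δ : ℝ≥0, t = δ ∧ (⨅ x ∈ Q.X, Q.tailProb P x δ) ≤ ENNReal.ofReal ε} ≤ h ε

/-- `x₀` is a Slater point. -/
def IsSlater (Q : UncertainProgram n D) (x₀ : EuclideanSpace ℝ (Fin n)) : Prop :=
  x₀ ∈ Q.X ∧ (⨆ d, Q.f x₀ d) < 0

/-- The constant `(min_{x ∈ X} cᵀx - cᵀx₀) / sup_d f(x₀, d)`. -/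
def slaterConst (Q : UncertainProgram n D) (c x₀ : EuclideanSpace ℝ (Fin n)) : ℝ :=
  (optValue c Q.X - inner ℝ c x₀) / ⨆ d, Q.f x₀ d

/-- `max_{x ∈ X} cᵀx - min_{x ∈ X} cᵀx`. -/
def objRange (Q : UncertainProgram n D) (c : EuclideanSpace ℝ (Fin n)) : ℝ :=
  sSup ((fun x => inner ℝ c x) '' Q.X) - optValue c Q.X

/-- `min {L h, max_X cᵀx - min_X cᵀx}` for `L ≥ 0` and a value `h ∈ [0, ∞]`. -/
def intervalLength (Q : UncertainProgram n D) (c : EuclideanSpace ℝ (Fin n)) (L : ℝ)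
    (h : ℝ≥0∞) : ℝ :=
  (min (ENNReal.ofReal L * h) (ENNReal.ofReal (Q.objRange c))).toReal

/-- Length `I(ε)` of the a priori interval. -/
def aPriori (Q : UncertainProgram n D) (c x₀ : EuclideanSpace ℝ (Fin n)) (h : ℝ → ℝ≥0∞)
    (ε : ℝ) : ℝ :=
  Q.intervalLength c (Q.slaterConst c x₀) (h ε)

/-- Length `I_N(ε)` of the a posteriori interval belonging to the multiplier vector `lam`. -/
def aPosteriori (Q : UncertainProgram n D) (c : EuclideanSpace ℝ (Fin n)) {N : ℕ}
    (lam : Fin N → ℝ) (h : ℝ → ℝ≥0∞) (ε : ℝ) : ℝ :=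
  Q.intervalLength c (∑ i, |lam i|) (h ε)

/-- Lagrange dual function of the scenario program. -/
def dualFun (Q : UncertainProgram n D) (c : EuclideanSpace ℝ (Fin n)) {N : ℕ} (d : Fin N → D)
    (lam : Fin N → ℝ) : ℝ :=
  sInf ((fun x => inner ℝ c x + ∑ i, lam i * Q.f x (d i)) '' Q.X)

/-- `lam` is an optimizer of the Lagrange dual of the scenario program. -/
def IsDualOptimizer (Q : UncertainProgram n D) (c : EuclideanSpace ℝ (Fin n)) {N : ℕ}
    (d : Fin N → D) (lam : Fin N → ℝ) : Prop :=
  (∀ i, 0 ≤ lam i) ∧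
    ∀ mu : Fin N → ℝ, (∀ i, 0 ≤ mu i) → Q.dualFun c d mu ≤ Q.dualFun c d lam

end UncertainProgram

/-- The least `N` with `∑ₖ ∑_{i<n} (N choose i) εₖⁱ (1-εₖ)^(N-i) ≤ β`; it is `∞` if there is
no such `N`. -/
def sampleBound (n : ℕ) {m : ℕ} (ε : Fin m → ℝ) (β : ℝ) : ℕ∞ :=
  sInf {t : ℕ∞ | ∃ N : ℕ, t = N ∧
    ∑ k, ∑ i ∈ Finset.range n, (N.choose i : ℝ) * ε k ^ i * (1 - ε k) ^ (N - i) ≤ β}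

/-- The event `E` has probability at least `q`.  No measurability of `E` is presupposed: `E` has
to contain a measurable set of probability at least `q`.  For measurable `E` this is `q ≤ μ E`. -/
def HoldsWithProb {Ω : Type*} [MeasurableSpace Ω] (μ : Measure Ω) (q : ℝ) (E : Set Ω) : Prop :=
  ∃ A : Set Ω, MeasurableSet A ∧ A ⊆ E ∧ q ≤ μ.real A

end

/-! ### Polynomial majorants of truncated powers. -/

noncomputable section
open Polynomial

/-! All three events contain one event: for every k the optimum over CCP_k is at most the optimum
over SCP_k. What remains is deterministic. A point of CCP_k violates its constraint by at most
h_k(ε_k) (`IsULB.exists_le_of_mem_chance`). Mixing with the Slater point repairs this at cost L_k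
h_k(ε_k) (`IsSlater.exists_robust_inner_le`), while strong duality prices it at ‖λ‖₁ h_k(ε_k)
(`IsDualOptimizer.optValue_scenario_le`).

The common event is controlled by the scenario bound `measureReal_satProb_lt_le` for nondegenerate
programs. By Helly, the minimizer for N samples is determined by at most n of them, and almost
surely by a unique irreducible subset, its basis. Given a basis of size k, the other N - k samples
only have to be satisfied. So the satisfaction probability t of the minimizer has law ∑_k (N choose
k) t^(N-k) dα_k, with measures α_k that do not depend on N. Total mass 1 for all N says that ∑_k ∫
D_k p dα_k = p(1) for every polynomial p, where D_k is the k-th Hasse derivative. Apply this to a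
polynomial G that, with its Hasse derivatives up to order n, majorizes t^N cut off at 1 - ε: the
probability of t < 1 - ε is at most G(1). Iterated integration of a Weierstrass approximant brings
G(1) arbitrarily close to the value at 1 of the Taylor polynomial of t^N at 1 - ε with n terms,
which is the binomial tail.

An arbitrary program is made nondegenerate by shrinking X towards a relative interior Slater point
(continuity), adding a small multiple of φ (strict convexity) and relaxing each constraint by a
uniform random amount (no atoms at equality). The total error κ then tends to 0. A union bound over
k and monotonicity of the tail in N conclude. -/

theorem Polynomial.exists_antiderivative (p : ℝ[X]) : ∃ q : ℝ[X], derivative q = p ∧ q.eval 0 = 0 := by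
  induction p using Polynomial.induction_on' with
  | add p q hp hq =>
    obtain ⟨p', hp, hp0⟩ := hp
    obtain ⟨q', hq, hq0⟩ := hq
    exact ⟨p' + q', by simp [hp, hq], by simp [hp0, hq0]⟩
  | monomial m a =>
    refine ⟨monomial (m + 1) (a / (m + 1)), ?_, by simp [eval_monomial]⟩
    rw [derivative_monomial]
    have : (m : ℝ) + 1 ≠ 0 := by positivity
    simp only [Nat.cast_add, Nat.cast_one, Nat.add_sub_cancel]
    rw [div_mul_cancel₀ _ this]

theorem Polynomial.eval_sub_le_of_derivative_le {p q : ℝ[X]} {a b : ℝ} (hab : a ≤ b)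
    (h : ∀ t ∈ Set.Icc a b, (derivative p).eval t ≤ (derivative q).eval t) :
    p.eval b - p.eval a ≤ q.eval b - q.eval a := by
  have hm : MonotoneOn (fun t => (q - p).eval t) (Set.Icc a b) := by
    refine monotoneOn_of_deriv_nonneg (convex_Icc a b) (q - p).continuous.continuousOn
      (q - p).differentiable.differentiableOn fun t ht => ?_
    rw [interior_Icc] at ht
    rw [Polynomial.deriv, derivative_sub, eval_sub]
    linarith [h t ⟨ht.1.le, ht.2.le⟩]
  have := hm (Set.left_mem_Icc.2 hab) (Set.right_mem_Icc.2 hab) hab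
  simp only [eval_sub] at this
  linarith

/-- The Taylor polynomial of order less than `m` of `t ^ M` at `τ`. -/
def powTaylor (τ : ℝ) (m M : ℕ) : ℝ[X] :=
  ∑ i ∈ Finset.range m, C ((M.choose i : ℝ) * τ ^ (M - i)) * (X - C τ) ^ i

theorem eval_powTaylor (τ : ℝ) (m M : ℕ) (t : ℝ) : (powTaylor τ m M).eval t =
    ∑ i ∈ Finset.range m, (M.choose i : ℝ) * τ ^ (M - i) * (t - τ) ^ i := by
  simp [powTaylor, eval_finsetSum]

theorem eval_powTaylor_self (τ : ℝ) (m M : ℕ) : (powTaylor τ (m + 1) M).eval τ = τ ^ M := by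
  rw [eval_powTaylor, Finset.sum_range_succ']
  simp

/-- Integrating (M + 1) times one Taylor polynomial gives the next, up to a constant. This drives
the induction on the order of majorization. -/
theorem derivative_powTaylor (τ : ℝ) (m M : ℕ) :
    derivative (powTaylor τ (m + 1) (M + 1)) = C ((M : ℝ) + 1) * powTaylor τ m M := by
  rw [powTaylor, Finset.sum_range_succ', powTaylor, Finset.mul_sum]
  simp only [derivative_add, derivative_sum]
  have h0 : derivative (C ((((M + 1).choose 0 : ℕ) : ℝ) * τ ^ (M + 1 - 0)) * (X - C τ) ^ 0) = 0 := by
    rw [pow_zero, mul_one, derivative_C]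
  rw [h0, add_zero]
  refine Finset.sum_congr rfl fun i _ => ?_
  rw [derivative_C_mul, derivative_X_sub_C_pow, Nat.add_sub_add_right, Nat.add_sub_cancel]
  have h := Nat.add_one_mul_choose_eq M i
  have h' : ((M : ℝ) + 1) * (M.choose i : ℝ) = ((M + 1).choose (i + 1) : ℝ) * ((i : ℝ) + 1) := by
    exact_mod_cast h
  rw [← mul_assoc, ← mul_assoc]
  congr 1
  rw [← C_mul, ← C_mul]
  congr 1
  push_cast
  linear_combination (-(τ ^ (M - i))) * h'

theorem hasseDeriv_derivative_eval (G : ℝ[X]) (k : ℕ) (t : ℝ) :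
    (hasseDeriv k (derivative G)).eval t = (k + 1) * (hasseDeriv (k + 1) G).eval t := by
  have h := congrArg (fun L => L G) (hasseDeriv_comp (R := ℝ) k 1)
  simp only [LinearMap.comp_apply, hasseDeriv_one', LinearMap.smul_apply] at h
  rw [h, Nat.choose_symm_add]
  simp

/-- `G` is a polynomial majorant, together with its first `n` derivatives, of `t ^ N` below `τ` and
of `0` above `τ`. -/
def MajorizesTruncPow (τ : ℝ) (n N : ℕ) (G : ℝ[X]) : Prop :=
  ∀ k ≤ n, ∀ t ∈ Set.Icc (0 : ℝ) 1, 0 ≤ (hasseDeriv k G).eval t ∧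
    (t < τ → (N.choose k : ℝ) * t ^ (N - k) ≤ (hasseDeriv k G).eval t)

/-- Multiply t^N by a ramp falling from 1 at τ to 0 at τ + η, and approximate it from above by a
polynomial with error at most 2η. After integration of N + 1 times this, the approximation costs at
most 2(N + 1)η and the ramp at most (N + 1)η, whence the choice of η. -/
theorem exists_majorizesTruncPow_zero {τ : ℝ} (hτ : τ ∈ Set.Icc (0 : ℝ) 1) (N : ℕ) {δ : ℝ}
    (hδ : 0 < δ) : ∃ G H : ℝ[X], MajorizesTruncPow τ 0 N G ∧ derivative H = C ((N : ℝ) + 1) * G ∧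
      H.eval 0 = 0 ∧ (∀ t ∈ Set.Icc 0 τ, H.eval t ≤ t ^ (N + 1) + δ) ∧
      ∀ t ∈ Set.Icc τ 1, H.eval t ≤ (powTaylor τ 1 (N + 1)).eval t + δ := by
  obtain ⟨hτ0, hτ1⟩ := hτ
  set η : ℝ := δ / (3 * (N + 1)) with hη
  have hN : (0 : ℝ) < N + 1 := by positivity
  have hη0 : 0 < η := by positivity
  have hδη : δ = 3 * ((N + 1) * η) := by rw [hη]; field_simp
  let φ : ℝ → ℝ := fun t => t ^ N * min 1 (max 0 ((τ + η - t) / η))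
  have hφ : Continuous φ := by fun_prop
  obtain ⟨p, hp⟩ := exists_polynomial_near_of_continuousOn 0 1 (fun t => φ t + η)
    (by fun_prop) η hη0
  have hp' : ∀ t ∈ Set.Icc (0 : ℝ) 1, φ t ≤ p.eval t ∧ p.eval t ≤ φ t + 2 * η := fun t ht => by
    have := abs_lt.1 (hp t ht)
    constructor <;> linarith
  have hφ0 : ∀ t ∈ Set.Icc (0 : ℝ) 1, 0 ≤ φ t ∧ φ t ≤ t ^ N ∧ φ t ≤ 1 := fun t ht => by
    have h1 : 0 ≤ min 1 (max 0 ((τ + η - t) / η)) := le_min zero_le_one (le_max_left _ _)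
    have h2 : min 1 (max 0 ((τ + η - t) / η)) ≤ 1 := min_le_left _ _
    have h3 : 0 ≤ t ^ N := pow_nonneg ht.1 _
    have h4 : φ t ≤ t ^ N := mul_le_of_le_one_right h3 h2
    exact ⟨mul_nonneg h3 h1, h4, h4.trans (pow_le_one₀ ht.1 ht.2)⟩
  obtain ⟨H, hH, hH0⟩ := Polynomial.exists_antiderivative (C ((N : ℝ) + 1) * p)
  have hlow : ∀ t ∈ Set.Icc 0 τ, H.eval t ≤ t ^ (N + 1) + 2 * ((N + 1) * η) := fun t ht => by
    have := Polynomial.eval_sub_le_of_derivative_le (p := H)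
      (q := X ^ (N + 1) + C (2 * ((N + 1) * η)) * X) ht.1 fun s hs => by
        have hs1 : s ∈ Set.Icc (0 : ℝ) 1 := ⟨hs.1, hs.2.trans (ht.2.trans hτ1)⟩
        rw [hH]
        simp only [eval_mul, eval_C, derivative_add, derivative_X_pow, eval_add, eval_pow, eval_X,
          derivative_C_mul, derivative_X, eval_one, Nat.add_sub_cancel]
        push_cast
        have := (hp' s hs1).2.trans (add_le_add_left (hφ0 s hs1).2.1 _)
        nlinarith
    simp only [eval_add, eval_pow, eval_X, eval_mul, eval_C, hH0] at this
    have h1 : 2 * ((N + 1) * η) * t ≤ 2 * ((N + 1) * η) * 1 :=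
      mul_le_mul_of_nonneg_left (ht.2.trans hτ1) (by positivity)
    have h2 : (0 : ℝ) ^ (N + 1) = 0 := by simp
    rw [h2] at this
    linarith
  have hup : ∀ t ∈ Set.Icc τ 1, H.eval t ≤ τ ^ (N + 1) + δ := fun t ht => by
    have hA : H.eval τ ≤ τ ^ (N + 1) + 2 * ((N + 1) * η) * τ := by
      have := Polynomial.eval_sub_le_of_derivative_le (p := H)
        (q := X ^ (N + 1) + C (2 * ((N + 1) * η)) * X) hτ0 fun s hs => by
          have hs1 : s ∈ Set.Icc (0 : ℝ) 1 := ⟨hs.1, hs.2.trans hτ1⟩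
          rw [hH]
          simp only [eval_mul, eval_C, derivative_add, derivative_X_pow, eval_add, eval_pow, eval_X,
            derivative_C_mul, derivative_X, eval_one, Nat.add_sub_cancel]
          push_cast
          have := (hp' s hs1).2.trans (add_le_add_left (hφ0 s hs1).2.1 _)
          nlinarith
      simp only [eval_add, eval_pow, eval_X, eval_mul, eval_C, hH0] at this
      have h2 : (0 : ℝ) ^ (N + 1) = 0 := by simp
      rw [h2] at this
      linarith
    set u := min t (τ + η) with hu
    have hτu : τ ≤ u := le_min ht.1 (by linarith)
    have hut : u ≤ t := min_le_left _ _
    have hB : H.eval u - H.eval τ ≤ (N + 1) * (1 + 2 * η) * (u - τ) := by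
      have := Polynomial.eval_sub_le_of_derivative_le (p := H)
        (q := C ((N + 1) * (1 + 2 * η)) * X) hτu fun s hs => by
          have hs1 : s ∈ Set.Icc (0 : ℝ) 1 := ⟨hτ0.trans hs.1, hs.2.trans (hut.trans ht.2)⟩
          rw [hH]
          simp only [eval_mul, eval_C, derivative_C_mul, derivative_X, eval_one]
          have := (hp' s hs1).2.trans (add_le_add_left (hφ0 s hs1).2.2 _)
          nlinarith
      simp only [eval_X, eval_mul, eval_C] at this
      linarith
    have hC : H.eval t - H.eval u ≤ (N + 1) * (2 * η) * (t - u) := by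
      rcases le_or_gt t (τ + η) with h | h
      · rw [hu, min_eq_left h]; simp
      have hu' : u = τ + η := min_eq_right h.le
      have := Polynomial.eval_sub_le_of_derivative_le (p := H)
        (q := C ((N + 1) * (2 * η)) * X) hut fun s hs => by
          have hs1 : s ∈ Set.Icc (0 : ℝ) 1 := ⟨hτ0.trans (hτu.trans hs.1), hs.2.trans ht.2⟩
          rw [hH]
          simp only [eval_mul, eval_C, derivative_C_mul, derivative_X, eval_one]
          have h0 : φ s = 0 := by
            have : (τ + η - s) / η ≤ 0 :=
              div_nonpos_of_nonpos_of_nonneg (by rw [hu'] at hs; linarith [hs.1]) hη0.le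
            simp [φ, max_eq_left this]
          have := (hp' s hs1).2
          rw [h0] at this
          nlinarith
      simp only [eval_X, eval_mul, eval_C] at this
      linarith
    have hu2 : u - τ ≤ η := by have := min_le_right t (τ + η); linarith
    have h1 : (N + 1) * (u - τ) ≤ (N + 1) * η := mul_le_mul_of_nonneg_left hu2 hN.le
    have h2 : 2 * ((N + 1) * η) * t ≤ 2 * ((N + 1) * η) * 1 :=
      mul_le_mul_of_nonneg_left ht.2 (by positivity)
    nlinarith
  refine ⟨p, H, ?_, hH, hH0, fun t ht => ?_, fun t ht => ?_⟩
  · intro k hk t ht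
    obtain rfl : k = 0 := by omega
    simp only [hasseDeriv_zero', Nat.choose_zero_right, Nat.cast_one, one_mul, Nat.sub_zero]
    refine ⟨(hφ0 t ht).1.trans (hp' t ht).1, fun htτ => le_trans (le_of_eq ?_) (hp' t ht).1⟩
    have h1 : 1 ≤ (τ + η - t) / η := by rw [le_div_iff₀ hη0]; linarith
    simp [φ, min_eq_left (h1.trans (le_max_right 0 _))]
  · have : 0 < (N + 1) * η := by positivity
    linarith [hlow t ht]
  · have h := hup t ht
    rw [eval_powTaylor]
    simpa using h

/-- The inductive hypothesis of `exists_majorizesTruncPow`: majorants of truncated powers whose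
antiderivatives are almost minimal. -/
def HasMajorants (τ : ℝ) (n : ℕ) : Prop :=
  ∀ (N : ℕ) (δ : ℝ), 0 < δ → ∃ G H : ℝ[X], MajorizesTruncPow τ n N G ∧
    derivative H = C ((N : ℝ) + 1) * G ∧
    H.eval 0 = 0 ∧ (∀ t ∈ Set.Icc 0 τ, H.eval t ≤ t ^ (N + 1) + δ) ∧
    ∀ t ∈ Set.Icc τ 1, H.eval t ≤ (powTaylor τ (n + 1) (N + 1)).eval t + δ

/-- The antiderivative H belonging to exponent N is itself the majorant for exponent N + 1. Its
Hasse derivative of order k + 1 is (N + 1)/(k + 1) times that of G of order k, so one more order is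
majorized, and the bounds on H become the pointwise bounds. For exponent 0 the constant 1 serves. -/
theorem HasMajorants.exists_pointwise {τ : ℝ} {n : ℕ}
    (ih : HasMajorants τ n) (N : ℕ) {δ : ℝ} (hδ : 0 < δ) :
    ∃ G : ℝ[X], MajorizesTruncPow τ (n + 1) N G ∧ (∀ t ∈ Set.Icc 0 τ, G.eval t ≤ t ^ N + δ) ∧
      ∀ t ∈ Set.Icc τ 1, G.eval t ≤ (powTaylor τ (n + 1) N).eval t + δ := by
  cases N with
  | zero =>
    refine ⟨1, fun k _ t ht => ?_, fun t _ => ?_, fun t _ => ?_⟩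
    · rcases Nat.eq_zero_or_pos k with rfl | hk
      · simp
      · simp [hasseDeriv_apply_one k hk, Nat.choose_eq_zero_of_lt hk]
    · simp; positivity
    · rw [eval_powTaylor, Finset.sum_range_succ']
      have : ∀ i ∈ Finset.range n, ((Nat.choose 0 (i + 1) : ℕ) : ℝ) * τ ^ (0 - (i + 1)) *
          (t - τ) ^ (i + 1) = 0 := fun i _ => by simp
      rw [Finset.sum_eq_zero this]
      simp; positivity
  | succ N =>
    obtain ⟨G, H, hG, hH, hH0, hlow, hup⟩ := ih N δ hδ
    refine ⟨H, fun k hk t ht => ?_, hlow, hup⟩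
    cases k with
    | zero =>
      have hn0 : ∀ u ∈ Set.Icc (0 : ℝ) 1, 0 ≤ H.eval u := fun u hu => by
        have := Polynomial.eval_sub_le_of_derivative_le (p := 0) (q := H) hu.1 fun s hs => by
          rw [hH]
          have := (hG 0 (Nat.zero_le _) s ⟨hs.1, hs.2.trans hu.2⟩).1
          rw [hasseDeriv_zero'] at this
          simp only [derivative_zero, eval_zero, eval_mul, eval_C]
          positivity
        simpa [hH0] using this
      simp only [hasseDeriv_zero', Nat.choose_zero_right, Nat.cast_one, one_mul, Nat.sub_zero]
      refine ⟨hn0 t ht, fun htτ => ?_⟩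
      have := Polynomial.eval_sub_le_of_derivative_le (p := X ^ (N + 1)) (q := H) ht.1
        fun s hs => by
          rw [hH]
          have := (hG 0 (Nat.zero_le _) s ⟨hs.1, hs.2.trans ht.2⟩).2 (hs.2.trans_lt htτ)
          simp only [hasseDeriv_zero', Nat.choose_zero_right, Nat.cast_one, one_mul,
            Nat.sub_zero] at this
          simp only [derivative_X_pow, eval_mul, eval_C, eval_pow, eval_X, Nat.add_sub_cancel]
          push_cast
          exact mul_le_mul_of_nonneg_left this (by positivity)
      simpa [hH0] using this
    | succ k =>
      have h1 := hG k (by omega) t ht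
      have h2 := hasseDeriv_derivative_eval H k t
      rw [hH, ← smul_eq_C_mul, map_smul, eval_smul, smul_eq_mul] at h2
      have hk0 : (0 : ℝ) < k + 1 := by positivity
      have hN0 : (0 : ℝ) < N + 1 := by positivity
      refine ⟨?_, fun htτ => ?_⟩
      · have := mul_nonneg hN0.le h1.1
        rw [h2] at this
        exact nonneg_of_mul_nonneg_right this hk0
      · have := mul_le_mul_of_nonneg_left (h1.2 htτ) hN0.le
        rw [h2] at this
        have h' : ((N : ℝ) + 1) * (N.choose k : ℝ) =
            ((N + 1).choose (k + 1) : ℝ) * ((k : ℝ) + 1) := by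
          exact_mod_cast Nat.add_one_mul_choose_eq N k
        rw [← mul_assoc, h', mul_comm _ ((k : ℝ) + 1), mul_assoc] at this
        rw [Nat.add_sub_add_right]
        exact le_of_mul_le_mul_left this hk0

/-- Each induction step integrates the pointwise bounds of `HasMajorants.exists_pointwise`, below τ
from 0 and above τ from τ; the tolerance δ / (N + 1) absorbs the factor N + 1. -/
theorem hasMajorants {τ : ℝ} (hτ : τ ∈ Set.Icc (0 : ℝ) 1) (n : ℕ) : HasMajorants τ n := by
  induction n with
  | zero => exact fun N δ hδ => exists_majorizesTruncPow_zero hτ N hδ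
  | succ n ih =>
    intro N δ hδ
    obtain ⟨hτ0, hτ1⟩ := hτ
    obtain ⟨G, hG, hGlow, hGup⟩ := ih.exists_pointwise N (δ := δ / (N + 1)) (by positivity)
    obtain ⟨H, hH, hH0⟩ := Polynomial.exists_antiderivative (C ((N : ℝ) + 1) * G)
    have hN : (0 : ℝ) < N + 1 := by positivity
    have key : ∀ t ∈ Set.Icc 0 τ, H.eval t ≤ t ^ (N + 1) + δ * t := fun t ht => by
      have := Polynomial.eval_sub_le_of_derivative_le (p := H)
        (q := X ^ (N + 1) + C δ * X) ht.1 fun s hs => by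
          rw [hH]
          simp only [eval_mul, eval_C, derivative_add, derivative_X_pow, eval_add, eval_pow,
            eval_X, derivative_C_mul, derivative_X, eval_one, Nat.add_sub_cancel]
          push_cast
          have := mul_le_mul_of_nonneg_left (hGlow s ⟨hs.1, hs.2.trans ht.2⟩) hN.le
          rw [mul_add, mul_div_cancel₀ _ hN.ne'] at this
          linarith
      simp only [eval_add, eval_pow, eval_X, eval_mul, eval_C, hH0] at this
      have h2 : (0 : ℝ) ^ (N + 1) = 0 := by simp
      rw [h2] at this
      linarith
    refine ⟨G, H, hG, hH, hH0, fun t ht => (key t ht).trans ?_, fun t ht => ?_⟩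
    · have := mul_le_of_le_one_right hδ.le (ht.2.trans hτ1)
      linarith
    · have := Polynomial.eval_sub_le_of_derivative_le (p := H)
        (q := powTaylor τ (n + 1 + 1) (N + 1) + C δ * X) ht.1 fun s hs => by
          rw [hH, derivative_add, derivative_powTaylor]
          simp only [eval_mul, eval_C, eval_add, derivative_C_mul, derivative_X, eval_one]
          have := mul_le_mul_of_nonneg_left (hGup s ⟨hs.1, hs.2.trans ht.2⟩) hN.le
          rw [mul_add, mul_div_cancel₀ _ hN.ne'] at this
          linarith
      simp only [eval_add, eval_X, eval_mul, eval_C, eval_powTaylor_self] at this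
      have h1 := key τ ⟨hτ0, le_rfl⟩
      have h2 := mul_le_of_le_one_right hδ.le ht.2
      linarith

/-! ### Binomial tails and the truncated moment inequality. -/

/-- Lower tail of the binomial distribution: probability of fewer than `n` successes in `N`
trials. -/
def binomTail (n N : ℕ) (ε : ℝ) : ℝ :=
  ∑ i ∈ Finset.range n, (N.choose i : ℝ) * ε ^ i * (1 - ε) ^ (N - i)

/-- At t = 1 the Taylor polynomial of t^N at 1 - ε with n terms is exactly the binomial tail.
Majorizing orders 0 to n costs only n terms, because the last antiderivative is bounded pointwise.
-/
theorem exists_majorant_eval_one_le {ε : ℝ} (hε : ε ∈ Set.Icc (0 : ℝ) 1) {n : ℕ} (hn : 0 < n)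
    (N : ℕ) {δ : ℝ} (hδ : 0 < δ) :
    ∃ G : ℝ[X], MajorizesTruncPow (1 - ε) n N G ∧ G.eval 1 ≤ binomTail n N ε + δ := by
  have hτ : 1 - ε ∈ Set.Icc (0 : ℝ) 1 := ⟨by linarith [hε.2], by linarith [hε.1]⟩
  obtain ⟨n, rfl⟩ := Nat.exists_eq_succ_of_ne_zero hn.ne'
  obtain ⟨G, hG, -, hup⟩ := (hasMajorants hτ n).exists_pointwise N hδ
  refine ⟨G, hG, (hup 1 ⟨hτ.2, le_rfl⟩).trans (le_of_eq ?_)⟩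
  rw [eval_powTaylor, binomTail]
  congr 1
  refine Finset.sum_congr rfl fun i _ => ?_
  rw [sub_sub_cancel]
  ring

theorem binomTail_nonneg {ε : ℝ} (hε : ε ∈ Set.Icc (0 : ℝ) 1) (n N : ℕ) : 0 ≤ binomTail n N ε :=
  Finset.sum_nonneg fun i _ => mul_nonneg (mul_nonneg (Nat.cast_nonneg _) (pow_nonneg hε.1 _))
    (pow_nonneg (by linarith [hε.2]) _)

theorem binomTail_succ_le {ε : ℝ} (hε : ε ∈ Set.Icc (0 : ℝ) 1) (n N : ℕ) :
    binomTail n (N + 1) ε ≤ binomTail n N ε := by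
  cases n with
  | zero => simp [binomTail]
  | succ n =>
    -- Condition on the outcome of one trial (Pascal's rule).
    have key : binomTail (n + 1) (N + 1) ε =
        ε * binomTail n N ε + (1 - ε) * binomTail (n + 1) N ε := by
      simp only [binomTail]
      rw [Finset.sum_range_succ', Finset.sum_range_succ' _ n, mul_add, Finset.mul_sum,
        Finset.mul_sum, ← add_assoc, ← Finset.sum_add_distrib]
      congr 1
      · refine Finset.sum_congr rfl fun i _ => ?_
        rw [Nat.choose_succ_succ, Nat.add_sub_add_right]
        push_cast
        rcases Nat.lt_or_ge N (i + 1) with h | h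
        · rw [Nat.choose_eq_zero_of_lt h]; push_cast; ring
        · obtain ⟨j, rfl⟩ := Nat.exists_eq_add_of_le h
          rw [show i + 1 + j - i = j + 1 by omega, show i + 1 + j - (i + 1) = j by omega]
          ring
      · simp only [Nat.choose_zero_right, Nat.sub_zero]; ring
    have hle : binomTail n N ε ≤ binomTail (n + 1) N ε := by
      simp only [binomTail]
      rw [Finset.sum_range_succ]
      refine le_add_of_nonneg_right (mul_nonneg (mul_nonneg (Nat.cast_nonneg _)
        (pow_nonneg hε.1 _)) (pow_nonneg (by linarith [hε.2]) _))
    rw [key]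
    nlinarith [hε.1]

theorem binomTail_anti {ε : ℝ} (hε : ε ∈ Set.Icc (0 : ℝ) 1) (n : ℕ) :
    Antitone fun N => binomTail n N ε :=
  antitone_nat_of_succ_le fun N => binomTail_succ_le hε n N

/-- If finite measures `α 0, …, α n` on `[0, 1]` satisfy
`∑ k ≤ n, (M choose k) ∫ t ^ (M - k) dα k = 1` for all `M`, then the truncated sum over `t < 1 - ε`
is bounded by the binomial tail. -/
theorem truncated_moment_le {n : ℕ} (hn : 0 < n) (α : ℕ → Measure ℝ) [∀ k, IsFiniteMeasure (α k)]
    (hα : ∀ k, ∀ᵐ t ∂α k, t ∈ Set.Icc (0 : ℝ) 1)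
    (hmom : ∀ M : ℕ, ∑ k ∈ Finset.range (n + 1), (M.choose k : ℝ) * ∫ t, t ^ (M - k) ∂α k = 1)
    {ε : ℝ} (hε : ε ∈ Set.Icc (0 : ℝ) 1) (N : ℕ) :
    ∑ k ∈ Finset.range (n + 1), (N.choose k : ℝ) * ∫ t in Set.Iio (1 - ε), t ^ (N - k) ∂α k ≤
      binomTail n N ε := by
  have hint : ∀ (k : ℕ) (p : ℝ[X]), Integrable (fun t => p.eval t) (α k) := fun k p => by
    obtain ⟨C, hC⟩ := (isCompact_Icc (a := (0 : ℝ)) (b := 1)).exists_bound_of_continuousOn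
      p.continuous.continuousOn
    exact Integrable.of_bound p.continuous.aestronglyMeasurable C
      ((hα k).mono fun t ht => hC t ht)
  -- On monomials this is the moment hypothesis; linearity gives the rest.
  have hlin : ∀ p : ℝ[X], ∑ k ∈ Finset.range (n + 1), ∫ t, (hasseDeriv k p).eval t ∂α k =
      p.eval 1 := fun p => by
    induction p using Polynomial.induction_on' with
    | add p q hp hq =>
      simp only [map_add, eval_add]
      rw [← hp, ← hq, ← Finset.sum_add_distrib]
      exact Finset.sum_congr rfl fun k _ => integral_add (hint k _) (hint k _)
    | monomial M a =>
      simp only [hasseDeriv_monomial, eval_monomial, one_pow, mul_one]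
      have := congrArg (fun s => a * s) (hmom M)
      simp only [Finset.mul_sum, mul_one] at this
      refine Eq.trans (Finset.sum_congr rfl fun k _ => ?_) this
      rw [integral_const_mul]
      ring
  refine le_of_forall_pos_le_add fun δ hδ => ?_
  obtain ⟨G, hG, hG1⟩ := exists_majorant_eval_one_le hε hn N hδ
  refine le_trans ?_ hG1
  rw [← hlin G]
  refine Finset.sum_le_sum fun k hk => ?_
  have hk' : k ≤ n := by simpa [Nat.lt_succ_iff] using hk
  rw [← integral_const_mul, ← integral_indicator measurableSet_Iio]
  refine integral_mono_ae ?_ (hint k _) ((hα k).mono fun t ht => ?_)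
  · refine Integrable.indicator ?_ measurableSet_Iio
    exact (hint k (C (N.choose k : ℝ) * X ^ (N - k))).congr (.of_forall fun t => by simp)
  · have h := hG k hk' t ht
    by_cases htτ : t < 1 - ε
    · simpa [Set.indicator_of_mem (show t ∈ Set.Iio (1 - ε) from htτ)] using h.2 htτ
    · simpa [Set.indicator_of_notMem (show t ∉ Set.Iio (1 - ε) from htτ)] using h.1

end

/-! ### Bases of strictly convex programs. -/

noncomputable section

/-- A strictly convex objective `g` over a compact convex set `K`, together with a family of
continuous convex constraints `F · w ≤ 0` having a common feasible point. -/
structure ConstraintFamily (E W : Type*) [NormedAddCommGroup E] [NormedSpace ℝ E]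
    [MeasurableSpace E] [MeasurableSpace W] where
  K : Set E
  g : E → ℝ
  F : E → W → ℝ
  isCompact_K : IsCompact K
  strictConvexOn_g : StrictConvexOn ℝ K g
  continuousOn_g : ContinuousOn g K
  convexOn_F : ∀ w, ConvexOn ℝ K fun x => F x w
  continuousOn_F : ∀ w, ContinuousOn (fun x => F x w) K
  measurable_F : Measurable fun z : K × W => F z.1 z.2
  exists_feasible : ∃ x ∈ K, ∀ w, F x w ≤ 0

namespace ConstraintFamily

variable {E W : Type*} [NormedAddCommGroup E] [NormedSpace ℝ E] [MeasurableSpace E]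
  [MeasurableSpace W] (C : ConstraintFamily E W) {ι κ : Type*}

theorem convex_K : Convex ℝ C.K := C.strictConvexOn_g.1

/-- Points satisfying the constraints with indices in `A`. -/
def feas (w : ι → W) (A : Set ι) : Set E := {x | x ∈ C.K ∧ ∀ i ∈ A, C.F x (w i) ≤ 0}

theorem feas_anti (w : ι → W) {A B : Set ι} (h : A ⊆ B) : C.feas w B ⊆ C.feas w A :=
  fun _ hx => ⟨hx.1, fun i hi => hx.2 i (h hi)⟩

theorem feas_comp (w : ι → W) (e : κ → ι) (A : Set κ) :
    C.feas (w ∘ e) A = C.feas w (e '' A) := by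
  ext x; simp [feas]

theorem convex_feas (w : ι → W) (A : Set ι) : Convex ℝ (C.feas w A) := by
  intro x hx y hy a b ha hb hab
  refine ⟨C.convex_K hx.1 hy.1 ha hb hab, fun i hi => ?_⟩
  have h := (C.convexOn_F (w i)).2 hx.1 hy.1 ha hb hab
  simp only [smul_eq_mul] at h
  nlinarith [hx.2 i hi, hy.2 i hi]

theorem exists_isMinOn_feas (w : ι → W) (A : Set ι) :
    ∃ x ∈ C.feas w A, ∀ y ∈ C.feas w A, C.g x ≤ C.g y := by
  have hcl : IsCompact (C.feas w A) := by
    have : C.feas w A = C.K ∩ ⋂ i ∈ A, (C.K ∩ (fun x => C.F x (w i)) ⁻¹' Set.Iic 0) := by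
      ext x; simp only [feas, Set.mem_ofPred_eq, Set.mem_inter_iff, Set.mem_iInter,
        Set.mem_preimage, Set.mem_Iic]
      exact ⟨fun h => ⟨h.1, fun i hi => ⟨h.1, h.2 i hi⟩⟩, fun h => ⟨h.1, fun i hi => (h.2 i hi).2⟩⟩
    rw [this]
    refine C.isCompact_K.inter_right (isClosed_biInter fun i _ => ?_)
    exact (C.continuousOn_F (w i)).preimage_isClosed_of_isClosed C.isCompact_K.isClosed isClosed_Iic
  have hne : (C.feas w A).Nonempty := by
    obtain ⟨x, hx, h⟩ := C.exists_feasible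
    exact ⟨x, hx, fun i _ => h _⟩
  obtain ⟨x, hx, h⟩ := hcl.exists_isMinOn hne (C.continuousOn_g.mono fun x hx => hx.1)
  exact ⟨x, hx, fun y hy => h hy⟩

/-- The minimizer of the objective under the constraints with indices in `A`. -/
def opt (w : ι → W) (A : Set ι) : E := (C.exists_isMinOn_feas w A).choose

theorem opt_mem (w : ι → W) (A : Set ι) : C.opt w A ∈ C.feas w A :=
  (C.exists_isMinOn_feas w A).choose_spec.1

theorem opt_mem_K (w : ι → W) (A : Set ι) : C.opt w A ∈ C.K := (C.opt_mem w A).1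

theorem g_opt_le {w : ι → W} {A : Set ι} {y : E} (hy : y ∈ C.feas w A) :
    C.g (C.opt w A) ≤ C.g y :=
  (C.exists_isMinOn_feas w A).choose_spec.2 y hy

theorem eq_opt {w : ι → W} {A : Set ι} {x : E} (hx : x ∈ C.feas w A)
    (h : C.g x ≤ C.g (C.opt w A)) : x = C.opt w A :=
  (C.strictConvexOn_g.subset (fun _ hx => hx.1) (C.convex_feas w A)).eq_of_isMinOn
    (fun _ hy => h.trans (C.g_opt_le hy)) (fun _ hy => C.g_opt_le hy) hx (C.opt_mem w A)

theorem opt_congr {w : ι → W} {A : Set ι} {w' : κ → W} {B : Set κ}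
    (h : C.feas w A = C.feas w' B) : C.opt w A = C.opt w' B :=
  C.eq_opt (h ▸ C.opt_mem w A) (C.g_opt_le (h.symm ▸ C.opt_mem w' B))

theorem opt_comp (w : ι → W) (e : κ → ι) (A : Set κ) :
    C.opt (w ∘ e) A = C.opt w (e '' A) :=
  C.opt_congr (C.feas_comp w e A)

theorem opt_eq_of_subset {w : ι → W} {A B : Set ι} (h : A ⊆ B)
    (hx : C.opt w A ∈ C.feas w B) : C.opt w A = C.opt w B :=
  C.eq_opt hx (C.g_opt_le (C.feas_anti w h (C.opt_mem w B)))

/-- By Helly's theorem, at most `dim E` constraints determine the minimizer. -/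
theorem exists_card_le_opt_eq [FiniteDimensional ℝ E] [Finite ι] (w : ι → W) :
    ∃ I : Finset ι, I.card ≤ Module.finrank ℝ E ∧ C.opt w I = C.opt w Set.univ := by
  classical
  have := Fintype.ofFinite ι
  set x := C.opt w Set.univ with hx
  let S : Option ι → Set E := fun o => o.elim {y | y ∈ C.K ∧ C.g y < C.g x}
    fun i => {y | y ∈ C.K ∧ C.F y (w i) ≤ 0}
  have hconv : ∀ o ∈ (Finset.univ : Finset (Option ι)), Convex ℝ (S o) := by
    rintro (_ | i) -
    · exact C.strictConvexOn_g.convexOn.convex_lt _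
    · exact (C.convexOn_F (w i)).convex_le _
  have hempty : ¬ (⋂ o ∈ (Finset.univ : Finset (Option ι)), S o).Nonempty := by
    rintro ⟨y, hy⟩
    simp only [Finset.mem_univ, Set.iInter_true, Set.mem_iInter] at hy
    have h0 := hy none
    exact absurd (C.g_opt_le (w := w) (A := Set.univ) ⟨h0.1, fun i _ => (hy (some i)).2⟩)
      (not_le.2 h0.2)
  have : ∃ J : Finset (Option ι), J.card ≤ Module.finrank ℝ E + 1 ∧
      ¬ (⋂ o ∈ J, S o).Nonempty := by
    by_contra! hcon
    exact hempty (Convex.helly_theorem' hconv fun J _ hJ => hcon J hJ)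
  obtain ⟨J, hJ, hJe⟩ := this
  -- The minimizer lies in every constraint set, so a subfamily with empty intersection must use the
  -- strict sublevel set. This leaves at most dim E constraints.
  have hnone : none ∈ J := by
    by_contra hn
    refine hJe ⟨x, Set.mem_iInter₂.2 ?_⟩
    rintro (_ | i) ho
    · exact absurd ho hn
    · exact ⟨C.opt_mem_K w _, (C.opt_mem w Set.univ).2 i trivial⟩
  refine ⟨J.eraseNone, ?_, ?_⟩
  · rw [Finset.card_eraseNone_of_mem hnone]
    omega
  · symm
    refine C.eq_opt (C.feas_anti w (Set.subset_univ _) (C.opt_mem w _)) ?_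
    by_contra! hlt
    refine hJe ⟨C.opt w J.eraseNone, Set.mem_iInter₂.2 ?_⟩
    rintro (_ | i) ho
    · exact ⟨C.opt_mem_K w _, hlt⟩
    · exact ⟨C.opt_mem_K w _, (C.opt_mem w _).2 i (by simpa using ho)⟩

/-- Every constraint with index in `A` matters for the minimizer belonging to `A`. -/
def Irreducible (w : ι → W) (A : Set ι) : Prop := ∀ i ∈ A, C.opt w (A \ {i}) ≠ C.opt w A

/-- `A` is irreducible and its minimizer satisfies all constraints. -/
def IsBasis (w : ι → W) (A : Set ι) : Prop :=
  C.Irreducible w A ∧ ∀ j ∉ A, C.F (C.opt w A) (w j) ≤ 0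

theorem opt_eq_of_isBasis {w : ι → W} {A : Set ι} (h : C.IsBasis w A) :
    C.opt w A = C.opt w Set.univ := by
  refine C.opt_eq_of_subset (Set.subset_univ _) ⟨C.opt_mem_K w _, fun i _ => ?_⟩
  by_cases hi : i ∈ A
  · exact (C.opt_mem w A).2 i hi
  · exact h.2 i hi

/-- An inclusion-minimal set among the small determining sets is irreducible. -/
theorem exists_isBasis [FiniteDimensional ℝ E] [Finite ι] (w : ι → W) :
    ∃ I : Finset ι, I.card ≤ Module.finrank ℝ E ∧ C.IsBasis w I := by
  classical
  obtain ⟨I, hI⟩ := C.exists_card_le_opt_eq w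
  obtain ⟨J, -, hJ⟩ := exists_minimal_le_of_wellFoundedLT
    (fun I : Finset ι => I.card ≤ Module.finrank ℝ E ∧ C.opt w I = C.opt w Set.univ) I hI
  refine ⟨J, hJ.prop.1, fun i hi heq => ?_, fun j _ => ?_⟩
  · have hle := hJ.le_of_le (y := J.erase i)
      ⟨(Finset.card_le_card (Finset.erase_subset _ _)).trans hJ.prop.1, by
        rw [Finset.coe_erase, heq, hJ.prop.2]⟩ (Finset.erase_subset _ _)
    exact Finset.notMem_erase i J (hle (by simpa using hi))
  · rw [hJ.prop.2]
    exact (C.opt_mem w Set.univ).2 j trivial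

/-- Constraints of an irreducible set are active at its minimizer. -/
theorem Irreducible.active {w : ι → W} {A : Set ι} (h : C.Irreducible w A) {i : ι} (hi : i ∈ A) :
    C.F (C.opt w A) (w i) = 0 := by
  set x := C.opt w A with hx
  set y := C.opt w (A \ {i}) with hy
  have hxf : x ∈ C.feas w A := C.opt_mem w A
  have hyf : y ∈ C.feas w (A \ {i}) := C.opt_mem w _
  refine le_antisymm (hxf.2 i hi) ?_
  by_contra! hlt
  have hgy : C.g y < C.g x := by
    by_contra! hle
    exact h i hi (C.eq_opt (C.feas_anti w Set.sdiff_subset hxf) hle).symm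
  -- Go from x towards the better point y, stopping where the chord of constraint i reaches 0, or at
  -- y itself. Having s > 0 makes the objective strictly smaller.
  obtain ⟨s, hs0, hs1, hs⟩ : ∃ s : ℝ, 0 < s ∧ s ≤ 1 ∧
      (1 - s) * C.F x (w i) + s * C.F y (w i) ≤ 0 := by
    rcases le_or_gt (C.F y (w i)) 0 with h0 | h0
    · exact ⟨1, one_pos, le_rfl, by linarith⟩
    · have hd : 0 < C.F y (w i) - C.F x (w i) := by linarith
      refine ⟨-C.F x (w i) / (C.F y (w i) - C.F x (w i)), div_pos (by linarith) hd,
        (div_le_one hd).2 (by linarith), le_of_eq ?_⟩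
      field_simp
      ring
  set z := (1 - s) • x + s • y with hz
  have hzK : z ∈ C.K := C.convex_K hxf.1 hyf.1 (by linarith) hs0.le (by ring)
  have hzf : z ∈ C.feas w A := by
    refine ⟨hzK, fun j hj => ?_⟩
    by_cases hji : j = i
    · subst hji
      have := (C.convexOn_F (w j)).2 hxf.1 hyf.1 (show 0 ≤ 1 - s by linarith) hs0.le (by ring)
      simp only [smul_eq_mul] at this
      linarith
    · exact (C.convex_feas w (A \ {i}) (C.feas_anti w Set.sdiff_subset hxf) hyf (by linarith)
        hs0.le (by ring)).2 j ⟨hj, hji⟩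
  have h1 := C.strictConvexOn_g.convexOn.2 hxf.1 hyf.1 (show 0 ≤ 1 - s by linarith) hs0.le
    (by ring)
  simp only [smul_eq_mul] at h1
  have h2 := C.g_opt_le hzf
  rw [← hx] at h2
  nlinarith

/-- If no constraint is active at the minimizer of the remaining ones, the basis is unique. -/
theorem isBasis_unique {w : ι → W} (hw : ∀ i, C.F (C.opt w {i}ᶜ) (w i) ≠ 0) {A : Set ι}
    (h : C.IsBasis w A) : A = {i | C.opt w {i}ᶜ ≠ C.opt w Set.univ} := by
  have hA := C.opt_eq_of_isBasis h
  ext i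
  simp only [Set.mem_ofPred_eq]
  refine ⟨fun hi heq => hw i ?_, fun hi => ?_⟩
  · rw [heq, ← hA]
    exact h.1.active C hi
  · by_contra hiA
    have hsub : A ⊆ {i}ᶜ := fun j hj hji => hiA (by rw [← Set.mem_singleton_iff.1 hji]; exact hj)
    refine hi ?_
    rw [← hA]
    refine (C.opt_eq_of_subset hsub ?_).symm
    rw [hA]
    exact C.feas_anti w (Set.subset_univ _) (C.opt_mem w _)

/-- Separates a condition on the selected samples from one condition on each remaining sample, the
form needed for integrating out the latter. -/
theorem isBasis_range_iff (w : ι → W) {e : κ → ι} (he : Function.Injective e) :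
    C.IsBasis w (Set.range e) ↔ C.Irreducible (w ∘ e) Set.univ ∧
      ∀ j ∉ Set.range e, C.F (C.opt (w ∘ e) Set.univ) (w j) ≤ 0 := by
  have h1 : ∀ i, C.opt (w ∘ e) (Set.univ \ {i}) = C.opt w (Set.range e \ {e i}) := fun i => by
    rw [C.opt_comp, Set.image_sdiff he, Set.image_univ, Set.image_singleton]
  have h2 : C.opt (w ∘ e) Set.univ = C.opt w (Set.range e) := by rw [C.opt_comp, Set.image_univ]
  simp only [IsBasis, Irreducible, h1, h2, Set.forall_mem_range, Set.mem_univ, forall_true_left]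

theorem measurable_F_right (x : C.K) : Measurable (C.F x) :=
  C.measurable_F.comp measurable_prodMk_left

/-! ### Measurability of the minimizer. -/

section Measurability

/-- The minimizer as a point of `K`. -/
def optK (w : ι → W) (A : Set ι) : C.K := ⟨C.opt w A, C.opt_mem_K w A⟩

/-- Compactness of S lets existence be tested on a countable dense subset with all inequalities
relaxed by 1/(m + 1), for every m. -/
theorem measurableSet_exists_feas [FiniteDimensional ℝ E] [Finite ι] (A : Set ι) {S : Set C.K}
    (hS : IsClosed S) (a : ℝ) :
    MeasurableSet {w : ι → W | ∃ x ∈ S, (∀ i ∈ A, C.F x (w i) ≤ 0) ∧ C.g x ≤ a} := by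
  have : CompactSpace C.K := isCompact_iff_compactSpace.1 C.isCompact_K
  have : ProperSpace E := FiniteDimensional.proper_real E
  obtain ⟨s, hsS, hsc, hs⟩ := (TopologicalSpace.IsSeparable.of_separableSpace S
    ).exists_countable_dense_subset
  have hgc : Continuous fun x : C.K => C.g x := C.continuousOn_g.domRestrict
  have hFc : ∀ b, Continuous fun x : C.K => C.F x b := fun b => (C.continuousOn_F b).domRestrict
  have heq : {w : ι → W | ∃ x ∈ S, (∀ i ∈ A, C.F x (w i) ≤ 0) ∧ C.g x ≤ a} =
      ⋂ m : ℕ, ⋃ x ∈ s, {w : ι → W | (∀ i ∈ A, C.F x (w i) < 1 / ((m : ℝ) + 1)) ∧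
        C.g x < a + 1 / ((m : ℝ) + 1)} := by
    ext w
    simp only [Set.mem_ofPred_eq, Set.mem_iInter, Set.mem_iUnion, exists_prop]
    constructor
    · rintro ⟨x, hxS, hxF, hxg⟩ m
      have hm : (0 : ℝ) < 1 / ((m : ℝ) + 1) := by positivity
      have hopen : IsOpen {y : C.K | (∀ i ∈ A, C.F y (w i) < 1 / ((m : ℝ) + 1)) ∧
          C.g y < a + 1 / ((m : ℝ) + 1)} := by
        have : {y : C.K | (∀ i ∈ A, C.F y (w i) < 1 / ((m : ℝ) + 1)) ∧
            C.g y < a + 1 / ((m : ℝ) + 1)} =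
            (⋂ i ∈ A, {y : C.K | C.F y (w i) < 1 / ((m : ℝ) + 1)}) ∩
              {y : C.K | C.g y < a + 1 / ((m : ℝ) + 1)} := by ext; simp
        rw [this]
        exact (A.toFinite.isOpen_biInter fun i _ => isOpen_lt (hFc _) continuous_const).inter
          (isOpen_lt hgc continuous_const)
      obtain ⟨y, hy, hys⟩ := mem_closure_iff.1 (hs hxS) _ hopen
        ⟨fun i hi => (hxF i hi).trans_lt hm, by linarith⟩
      exact ⟨y, hys, hy⟩
    · intro h
      choose x hxs hxF hxg using h
      obtain ⟨y, hyS, φ, hφ, hlim⟩ := hS.isCompact.tendsto_subseq fun m => hsS (hxs m)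
      have h0 : Filter.Tendsto (fun m : ℕ => 1 / ((φ m : ℝ) + 1)) Filter.atTop (nhds 0) :=
        tendsto_one_div_add_atTop_nhds_zero_nat.comp hφ.tendsto_atTop
      refine ⟨y, hyS, fun i hi => ?_, ?_⟩
      · exact le_of_tendsto_of_tendsto' (((hFc (w i)).tendsto y).comp hlim) h0
          fun m => (hxF (φ m) i hi).le
      · have h1 := h0.const_add a
        rw [add_zero] at h1
        exact le_of_tendsto_of_tendsto' ((hgc.tendsto y).comp hlim) h1 fun m => (hxg (φ m)).le
  rw [heq]
  refine MeasurableSet.iInter fun m => MeasurableSet.biUnion hsc fun x _ => ?_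
  have hset : {w : ι → W | (∀ i ∈ A, C.F x (w i) < 1 / ((m : ℝ) + 1)) ∧
      C.g x < a + 1 / ((m : ℝ) + 1)} = (⋂ i ∈ A, {w : ι → W | C.F x (w i) < 1 / ((m : ℝ) + 1)}) ∩
        {_w : ι → W | C.g x < a + 1 / ((m : ℝ) + 1)} := by
    ext; simp
  rw [hset]
  refine MeasurableSet.inter (A.toFinite.measurableSet_biInter fun i _ => ?_)
    (MeasurableSet.const _)
  exact measurableSet_lt ((C.measurable_F_right x).comp (measurable_pi_apply i)) measurable_const

variable [BorelSpace E]

/-- The minimizer lies in a closed S iff every rational objective level attained by a feasible point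
is attained by one in S; compactness and uniqueness of the minimizer give the converse direction. -/
theorem measurable_optK [FiniteDimensional ℝ E] [Finite ι] (A : Set ι) :
    Measurable fun w : ι → W => C.optK w A := by
  have : CompactSpace C.K := isCompact_iff_compactSpace.1 C.isCompact_K
  refine measurable_of_isClosed fun S hS => ?_
  have heq : (fun w : ι → W => C.optK w A) ⁻¹' S = ⋂ a : ℚ,
      ({w : ι → W | ∃ x ∈ (Set.univ : Set C.K), (∀ i ∈ A, C.F x (w i) ≤ 0) ∧ C.g x ≤ a}ᶜ ∪
        {w : ι → W | ∃ x ∈ S, (∀ i ∈ A, C.F x (w i) ≤ 0) ∧ C.g x ≤ a}) := by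
    ext w
    simp only [Set.mem_preimage, Set.mem_iInter, Set.mem_union, Set.mem_compl_iff,
      Set.mem_ofPred_eq, ← imp_iff_not_or]
    constructor
    · rintro hw a ⟨x, -, hxF, hxg⟩
      exact ⟨_, hw, (C.opt_mem w A).2, (C.g_opt_le ⟨x.2, hxF⟩).trans hxg⟩
    · intro h
      have h' : ∀ m : ℕ, ∃ x ∈ S, (∀ i ∈ A, C.F x (w i) ≤ 0) ∧
          C.g x ≤ C.g (C.opt w A) + 1 / ((m : ℝ) + 1) := fun m => by
        have hm : (0 : ℝ) < 1 / ((m : ℝ) + 1) := by positivity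
        obtain ⟨a, ha1, ha2⟩ := exists_rat_btwn
          (lt_add_of_pos_right (C.g (C.opt w A)) hm)
        obtain ⟨x, hxS, hxF, hxg⟩ := h a ⟨C.optK w A, trivial, (C.opt_mem w A).2, ha1.le⟩
        exact ⟨x, hxS, hxF, hxg.trans ha2.le⟩
      choose x hxS hxF hxg using h'
      obtain ⟨y, hyS, φ, hφ, hlim⟩ := hS.isCompact.tendsto_subseq hxS
      have h0 : Filter.Tendsto (fun m : ℕ => 1 / ((φ m : ℝ) + 1)) Filter.atTop (nhds 0) :=
        tendsto_one_div_add_atTop_nhds_zero_nat.comp hφ.tendsto_atTop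
      have hyF : ∀ i ∈ A, C.F y (w i) ≤ 0 := fun i hi =>
        le_of_tendsto' ((((C.continuousOn_F (w i)).domRestrict).tendsto y).comp hlim)
          fun m => hxF (φ m) i hi
      have h1 := h0.const_add (C.g (C.opt w A))
      rw [add_zero] at h1
      have hyg := le_of_tendsto_of_tendsto' ((C.continuousOn_g.domRestrict.tendsto y).comp hlim) h1
        fun m => hxg (φ m)
      have hy : y = C.optK w A := Subtype.ext (C.eq_opt ⟨y.2, hyF⟩ hyg)
      exact hy ▸ hyS
  rw [heq]
  exact MeasurableSet.iInter fun a =>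
    (C.measurableSet_exists_feas A isClosed_univ a).compl.union (C.measurableSet_exists_feas A hS a)

theorem measurableSet_irreducible [FiniteDimensional ℝ E] [Finite ι] (A : Set ι) :
    MeasurableSet {w : ι → W | C.Irreducible w A} := by
  have : ProperSpace E := FiniteDimensional.proper_real E
  have : {w : ι → W | C.Irreducible w A} =
      ⋂ i ∈ A, {w : ι → W | (C.optK w (A \ {i}) : E) = C.optK w A}ᶜ := by
    ext; simp [Irreducible, optK]
  rw [this]
  exact A.toFinite.measurableSet_biInter fun i _ => (measurableSet_eq_fun
    (measurable_subtype_coe.comp (C.measurable_optK _))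
    (measurable_subtype_coe.comp (C.measurable_optK _))).compl

end Measurability

end ConstraintFamily

/-! ### Law of the minimizer and the scenario bound. -/

/-- Integrating out the coordinates outside the range of an injection. -/
theorem pi_measure_setOf_forall_notMem_range {W ι κ : Type*} [MeasurableSpace W] [Fintype ι]
    [Fintype κ] (Q : Measure W) [IsProbabilityMeasure Q] {e : κ → ι} (he : Function.Injective e)
    {A : Set (κ → W)} (hA : MeasurableSet A) {S : Set ((κ → W) × W)} (hS : MeasurableSet S) :
    Measure.pi (fun _ : ι => Q) {w | w ∘ e ∈ A ∧ ∀ j ∉ Set.range e, (w ∘ e, w j) ∈ S} =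
      ∫⁻ a in A, Q {b | (a, b) ∈ S} ^ (Fintype.card ι - Fintype.card κ)
        ∂Measure.pi (fun _ : κ => Q) := by
  classical
  obtain ⟨p, hp⟩ : ∃ p : ι → Prop, ∀ j, j ∈ Set.range e ↔ p j := ⟨_, fun _ => Iff.rfl⟩
  let σ : κ ≃ {j // p j} := (Equiv.ofInjective e he).trans (Equiv.subtypeEquivRight hp)
  let T : (ι → W) → (κ → W) × ({j // ¬ p j} → W) := fun w => (w ∘ e, fun j => w j)
  have hT : MeasurePreserving T (Measure.pi fun _ : ι => Q)
      ((Measure.pi fun _ : κ => Q).prod (Measure.pi fun _ : {j // ¬ p j} => Q)) := by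
    have h1 := measurePreserving_piEquivPiSubtypeProd (fun _ : ι => Q) p
    have h2 := ((measurePreserving_piCongrLeft (fun _ : {j // p j} => Q)
      σ).symm).prod
        (MeasurePreserving.id (Measure.pi fun _ : {j // ¬ p j} => Q))
    have h3 := h2.comp h1
    exact h3
  let B : Set ((κ → W) × ({j // ¬ p j} → W)) := {z | z.1 ∈ A ∧ ∀ j, (z.1, z.2 j) ∈ S}
  have hB : MeasurableSet B := by
    have : B = Prod.fst ⁻¹' A ∩
        ⋂ j, (fun z : (κ → W) × ({j // ¬ p j} → W) => (z.1, z.2 j)) ⁻¹' S := by ext; simp [B]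
    rw [this]
    exact (measurable_fst hA).inter (MeasurableSet.iInter fun j =>
      (measurable_fst.prodMk ((measurable_pi_apply j).comp measurable_snd)) hS)
  have hpre : {w : ι → W | w ∘ e ∈ A ∧ ∀ j ∉ Set.range e, (w ∘ e, w j) ∈ S} = T ⁻¹' B := by
    ext w
    simp only [T, B, hp, Set.mem_ofPred_eq, Set.mem_preimage, Subtype.forall]
  rw [hpre, hT.measure_preimage hB.nullMeasurableSet, Measure.prod_apply hB, ← lintegral_indicator hA]
  refine lintegral_congr fun a => ?_
  by_cases ha : a ∈ A
  · have : Prod.mk a ⁻¹' B = Set.univ.pi fun _ => {b | (a, b) ∈ S} := by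
      ext b; simp [B, ha]
    rw [this, Measure.pi_pi, Finset.prod_const, Set.indicator_of_mem ha, Finset.card_univ]
    congr 1
    rw [Fintype.card_subtype_compl]
    congr 1
    exact (Fintype.card_congr σ).symm
  · have : Prod.mk a ⁻¹' B = ∅ := by
      ext b; simp [B, ha]
    rw [this, measure_empty, Set.indicator_of_notMem ha]

end

noncomputable section

namespace ConstraintFamily

variable {E W : Type*} [NormedAddCommGroup E] [NormedSpace ℝ E] [MeasurableSpace E]
  [MeasurableSpace W] (C : ConstraintFamily E W) {ι κ : Type*}

/-- Probability that a random constraint is satisfied at `x`. -/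
def satProb (Q : Measure W) (x : E) : ℝ≥0∞ := Q {b | C.F x b ≤ 0}

theorem measurable_satProb (Q : Measure W) [IsProbabilityMeasure Q] :
    Measurable fun x : C.K => C.satProb Q x := by
  have h : MeasurableSet {z : C.K × W | C.F z.1 z.2 ≤ 0} :=
    measurableSet_le C.measurable_F measurable_const
  exact measurable_measure_prodMk_left h

variable [BorelSpace E] [FiniteDimensional ℝ E] (Q : Measure W) [IsProbabilityMeasure Q]

theorem measurable_F_opt [Finite κ] (A : Set κ) :
    Measurable fun z : (κ → W) × W => C.F (C.opt z.1 A) z.2 :=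
  C.measurable_F.comp (((C.measurable_optK A).comp measurable_fst).prodMk measurable_snd)

/-- The minimizer without sample i is independent of sample i, so Fubini reduces this to `hQ`. It
supplies the almost sure uniqueness of the basis. -/
theorem ae_F_opt_compl_ne_zero [Fintype ι] (hQ : ∀ x ∈ C.K, Q {b | C.F x b = 0} = 0) :
    ∀ᵐ w ∂Measure.pi (fun _ : ι => Q), ∀ i, C.F (C.opt w {i}ᶜ) (w i) ≠ 0 := by
  classical
  refine ae_all_iff.2 fun i => ?_
  rw [ae_iff]
  let e : {j // j ≠ i} → ι := Subtype.val
  have hr : Set.range e = {i}ᶜ := by ext; simp [e]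
  have h := pi_measure_setOf_forall_notMem_range Q (e := e) Subtype.val_injective
    (A := Set.univ) MeasurableSet.univ
    (S := {z | C.F (C.opt z.1 Set.univ) z.2 = 0})
    (measurableSet_eq_fun (C.measurable_F_opt _) measurable_const)
  have hcard : Fintype.card ι - Fintype.card {j // j ≠ i} = 1 := by
    have h1 : Fintype.card {j // j ≠ i} = Fintype.card ι - 1 := by simp
    have h2 : 0 < Fintype.card ι := Fintype.card_pos_iff.2 ⟨i⟩
    omega
  have hz : ∀ a : {j // j ≠ i} → W, Q {b | (a, b) ∈ {z : ({j // j ≠ i} → W) × W |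
      C.F (C.opt z.1 Set.univ) z.2 = 0}} = 0 := fun a => hQ _ (C.opt_mem_K a _)
  simp only [hcard, hz, pow_one, lintegral_zero] at h
  rw [← h]
  congr 1
  ext w
  simp only [Set.mem_ofPred_eq, not_not, hr, Set.mem_univ, true_and, Set.mem_compl_iff,
    Set.mem_singleton_iff, forall_eq, C.opt_comp, Set.image_univ]

/-- Given the samples in the basis, the others are independent and each is satisfied with
probability `satProb`, which explains the power. -/
theorem measure_isBasis_range [Fintype ι] [Fintype κ] {e : κ → ι} (he : Function.Injective e)
    {T : Set C.K} (hT : MeasurableSet T) :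
    Measure.pi (fun _ : ι => Q) {w | C.IsBasis w (Set.range e) ∧ C.optK w Set.univ ∈ T} =
      ∫⁻ a in {a : κ → W | C.Irreducible a Set.univ ∧ C.optK a Set.univ ∈ T},
        C.satProb Q (C.opt a Set.univ) ^ (Fintype.card ι - Fintype.card κ)
        ∂Measure.pi (fun _ : κ => Q) := by
  have h := pi_measure_setOf_forall_notMem_range Q he
    (A := {a : κ → W | C.Irreducible a Set.univ ∧ C.optK a Set.univ ∈ T})
    ((C.measurableSet_irreducible _).inter (C.measurable_optK _ hT))
    (S := {z | C.F (C.opt z.1 Set.univ) z.2 ≤ 0})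
    (measurableSet_le (C.measurable_F_opt _) measurable_const)
  refine Eq.trans ?_ h
  congr 1
  ext w
  simp only [Set.mem_ofPred_eq, C.isBasis_range_iff w he]
  have key : C.Irreducible (w ∘ e) Set.univ ∧
      (∀ j ∉ Set.range e, C.F (C.opt (w ∘ e) Set.univ) (w j) ≤ 0) →
      C.optK w Set.univ = C.optK (w ∘ e) Set.univ := fun h => by
    have := C.opt_eq_of_isBasis ((C.isBasis_range_iff w he).2 h)
    refine Subtype.ext ?_
    simp only [optK]
    rw [← this, C.opt_comp, Set.image_univ]
  constructor
  · rintro ⟨h1, h2⟩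
    exact ⟨⟨h1.1, key h1 ▸ h2⟩, h1.2⟩
  · rintro ⟨⟨h1, h2⟩, h3⟩
    exact ⟨⟨h1, h3⟩, (key ⟨h1, h3⟩).symm ▸ h2⟩

theorem measurableSet_isBasis [Finite ι] (A : Set ι) : MeasurableSet {w : ι → W | C.IsBasis w A} := by
  have : {w : ι → W | C.IsBasis w A} = {w | C.Irreducible w A} ∩
      ⋂ j ∈ Aᶜ, {w | C.F (C.optK w A) (w j) ≤ 0} := by
    ext; simp [IsBasis, optK]
  rw [this]
  refine (C.measurableSet_irreducible A).inter (Aᶜ.toFinite.measurableSet_biInter fun j _ => ?_)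
  exact measurableSet_le (C.measurable_F.comp ((C.measurable_optK A).prodMk
    (measurable_pi_apply j))) measurable_const

/-- Decomposition of the law of the minimizer according to the size of its basis. -/
theorem measure_optK_mem (hQ : ∀ x ∈ C.K, Q {b | C.F x b = 0} = 0) {n : ℕ}
    (hn : Module.finrank ℝ E ≤ n) {T : Set C.K} (hT : MeasurableSet T) (N : ℕ) :
    Measure.pi (fun _ : Fin N => Q) {w | C.optK w Set.univ ∈ T} =
      ∑ k ∈ Finset.range (n + 1), N.choose k *
        ∫⁻ a in {a : Fin k → W | C.Irreducible a Set.univ ∧ C.optK a Set.univ ∈ T},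
          C.satProb Q (C.opt a Set.univ) ^ (N - k) ∂Measure.pi (fun _ : Fin k => Q) := by
  classical
  let J : Finset (Finset (Fin N)) := Finset.univ.filter fun I => I.card < n + 1
  let B : Finset (Fin N) → Set (Fin N → W) := fun I =>
    {w | C.IsBasis w (I : Set (Fin N)) ∧ C.optK w Set.univ ∈ T}
  have hB : ∀ I, MeasurableSet (B I) := fun I =>
    (C.measurableSet_isBasis _).inter (C.measurable_optK _ hT)
  have hset : {w : Fin N → W | C.optK w Set.univ ∈ T} = ⋃ I ∈ J, B I := by
    ext w
    simp only [Set.mem_ofPred_eq, Set.mem_iUnion, B, exists_prop]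
    constructor
    · intro hw
      obtain ⟨I, hI, hIB⟩ := C.exists_isBasis w
      exact ⟨I, by simp [J]; omega, hIB, hw⟩
    · rintro ⟨I, -, -, h⟩
      exact h
  have hdisj : (J : Set (Finset (Fin N))).Pairwise
      (Function.onFun (AEDisjoint (Measure.pi fun _ : Fin N => Q)) B) := by
    intro I _ I' _ hne
    refine measure_mono_null ?_ (ae_iff.1 (C.ae_F_opt_compl_ne_zero (ι := Fin N) Q hQ))
    rintro w ⟨h1, h2⟩ hw
    refine hne (Finset.coe_injective ?_)
    rw [C.isBasis_unique hw h1.1, C.isBasis_unique hw h2.1]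
  rw [hset, measure_biUnion_finset₀ hdisj fun I _ => (hB I).nullMeasurableSet]
  let c : ℕ → ℝ≥0∞ := fun k =>
    ∫⁻ a in {a : Fin k → W | C.Irreducible a Set.univ ∧ C.optK a Set.univ ∈ T},
      C.satProb Q (C.opt a Set.univ) ^ (N - k) ∂Measure.pi (fun _ : Fin k => Q)
  have hc : ∀ I ∈ J, Measure.pi (fun _ : Fin N => Q) (B I) = c I.card := fun I _ => by
    have := C.measure_isBasis_range Q (I.orderEmbOfFin rfl).injective hT
    rw [Finset.range_orderEmbOfFin] at this
    simpa [B, c] using this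
  rw [Finset.sum_congr rfl hc, ← Finset.sum_fiberwise_of_maps_to (t := Finset.range (n + 1))
    (g := Finset.card) (fun I hI => by simpa [J] using hI)]
  refine Finset.sum_congr rfl fun k hk => ?_
  have hk' : k < n + 1 := by simpa using hk
  have hf : J.filter (fun I => I.card = k) = Finset.powersetCard k Finset.univ := by
    ext I
    simp only [J, Finset.mem_filter, Finset.mem_univ, true_and, Finset.mem_powersetCard,
      Finset.subset_univ]
    exact ⟨fun h => h.2, fun h => ⟨h ▸ hk', h⟩⟩
  rw [hf, Finset.sum_congr rfl fun I hI => by rw [(Finset.mem_powersetCard.1 hI).2],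
    Finset.sum_const, Finset.card_powersetCard, nsmul_eq_mul]
  simp [c]

/-- **Scenario bound**: the minimizer for `N` independent constraints violates more than a fraction
`ε` of all constraints with probability at most the binomial tail. -/
theorem measureReal_satProb_lt_le (hQ : ∀ x ∈ C.K, Q {b | C.F x b = 0} = 0) {n : ℕ} (hn0 : 0 < n)
    (hn : Module.finrank ℝ E ≤ n) {ε : ℝ} (hε : ε ∈ Set.Icc (0 : ℝ) 1) (N : ℕ) :
    (Measure.pi (fun _ : Fin N => Q)).real
      {w | (C.satProb Q (C.opt w Set.univ)).toReal < 1 - ε} ≤ binomTail n N ε := by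
  let s : ∀ k, (Fin k → W) → ℝ := fun k a => (C.satProb Q (C.opt a Set.univ)).toReal
  have hsm : ∀ k, Measurable (s k) := fun k =>
    ((C.measurable_satProb Q).comp (C.measurable_optK Set.univ)).ennreal_toReal
  have hs0 : ∀ k a, 0 ≤ s k a := fun k a => ENNReal.toReal_nonneg
  have hs1 : ∀ k a, s k a ≤ 1 := fun k a =>
    ENNReal.toReal_le_of_le_ofReal zero_le_one (by simpa [satProb] using prob_le_one)
  have hsE : ∀ k a, C.satProb Q (C.opt a Set.univ) = ENNReal.ofReal (s k a) := fun k a =>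
    (ENNReal.ofReal_toReal (measure_ne_top _ _)).symm
  let ρ : ∀ k, Measure (Fin k → W) := fun k =>
    (Measure.pi fun _ : Fin k => Q).restrict {a | C.Irreducible a Set.univ}
  -- These measures do not involve the sample size M, so the identities for all M constrain the same
  -- α.
  let α : ℕ → Measure ℝ := fun k => (ρ k).map (s k)
  have hfin : ∀ k, IsFiniteMeasure (α k) := fun k => by dsimp only [α, ρ]; infer_instance
  have hα : ∀ k, ∀ᵐ t ∂α k, t ∈ Set.Icc (0 : ℝ) 1 := fun k =>
    (ae_map_iff (hsm k).aemeasurable measurableSet_Icc).2 (.of_forall fun a => ⟨hs0 k a, hs1 k a⟩)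
  have hlaw : ∀ (M : ℕ) (S : Set ℝ), MeasurableSet S →
      (Measure.pi (fun _ : Fin M => Q)).real {w | s M w ∈ S} =
        ∑ k ∈ Finset.range (n + 1), (M.choose k : ℝ) * ∫ t in S, t ^ (M - k) ∂α k := by
    intro M S hS
    have hT : MeasurableSet {x : C.K | (C.satProb Q x).toReal ∈ S} :=
      (C.measurable_satProb Q).ennreal_toReal hS
    have h := C.measure_optK_mem Q hQ hn hT M
    have hint : ∀ k, ∫⁻ a in {a : Fin k → W | C.Irreducible a Set.univ ∧
        C.optK a Set.univ ∈ {x : C.K | (C.satProb Q x).toReal ∈ S}},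
          C.satProb Q (C.opt a Set.univ) ^ (M - k) ∂Measure.pi (fun _ : Fin k => Q) =
        ENNReal.ofReal (∫ t in S, t ^ (M - k) ∂α k) := fun k => by
      have hset : {a : Fin k → W | C.Irreducible a Set.univ ∧
          C.optK a Set.univ ∈ {x : C.K | (C.satProb Q x).toReal ∈ S}} =
          (s k ⁻¹' S) ∩ {a | C.Irreducible a Set.univ} := by
        ext a; simp [s, optK, and_comm]
      rw [hset, ← Measure.restrict_restrict (hsm k hS),
        setIntegral_map hS (by fun_prop) (hsm k).aemeasurable,
        ofReal_integral_eq_lintegral_ofReal]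
      · refine lintegral_congr fun a => ?_
        rw [hsE k a, ENNReal.ofReal_pow (hs0 k a)]
      · exact Integrable.of_bound ((hsm k).pow_const _).aestronglyMeasurable 1
          (.of_forall fun a => by
            rw [Real.norm_of_nonneg (pow_nonneg (hs0 k a) _)]
            exact pow_le_one₀ (hs0 k a) (hs1 k a))
      · exact .of_forall fun a => pow_nonneg (hs0 k a) _
    simp only [hint] at h
    have hset : {w : Fin M → W | C.optK w Set.univ ∈ {x : C.K | (C.satProb Q x).toReal ∈ S}} =
        {w | s M w ∈ S} := rfl
    rw [hset] at h
    rw [Measure.real, h, ENNReal.toReal_sum fun k _ =>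
      ENNReal.mul_ne_top (ENNReal.natCast_ne_top _) ENNReal.ofReal_ne_top]
    refine Finset.sum_congr rfl fun k _ => ?_
    rw [ENNReal.toReal_mul, ENNReal.toReal_natCast, ENNReal.toReal_ofReal]
    exact integral_nonneg_of_ae ((ae_restrict_of_ae (hα k)).mono fun t ht => pow_nonneg ht.1 _)
  refine le_trans (le_of_eq ?_) (truncated_moment_le hn0 α hα (fun M => ?_) hε N)
  · exact hlaw N (Set.Iio (1 - ε)) measurableSet_Iio
  · have := hlaw M Set.univ MeasurableSet.univ
    simp only [Set.mem_univ, Measure.restrict_univ] at this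
    rw [← this]
    simp

end ConstraintFamily

end

/-! ### Convex analysis: relative interiors and Lagrange multipliers. -/

noncomputable section

section Convex

variable {E : Type*} [NormedAddCommGroup E] [NormedSpace ℝ E]

/-- `X` contains the ball of radius `r` around `z` relative to `z + V`, and `X ⊆ z + V`. -/
def HasRelBall (X : Set E) (V : Submodule ℝ E) (z : E) (r : ℝ) : Prop :=
  (∀ x ∈ X, x - z ∈ V) ∧ ∀ v ∈ V, ‖v‖ ≤ r → z + v ∈ X

theorem exists_hasRelBall [FiniteDimensional ℝ E] {X : Set E} (hX : Convex ℝ X)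
    (hne : X.Nonempty) : ∃ z ∈ X, ∃ (V : Submodule ℝ E) (r : ℝ), 0 < r ∧ HasRelBall X V z r := by
  obtain ⟨z, hz⟩ := hne.intrinsicInterior hX
  obtain ⟨y, hy, rfl⟩ := mem_intrinsicInterior.1 hz
  let V := (affineSpan ℝ X).direction
  let m : V → affineSpan ℝ X := fun v =>
    ⟨(v : E) + y, AffineSubspace.vadd_mem_of_mem_direction v.2 y.2⟩
  have hm : Continuous m := by fun_prop
  have h0 : m 0 = y := by ext; simp [m]
  have hn : m ⁻¹' interior ((↑) ⁻¹' X) ∈ nhds (0 : V) :=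
    hm.continuousAt.preimage_mem_nhds (by rw [h0]; exact isOpen_interior.mem_nhds hy)
  obtain ⟨r, hr, hball⟩ := Metric.mem_nhds_iff.1 hn
  refine ⟨y, intrinsicInterior_subset hz, V, r / 2, by positivity, fun x hx => ?_, fun v hv hvr => ?_⟩
  · exact AffineSubspace.vsub_mem_direction (subset_affineSpan ℝ X hx) y.2
  · have : (⟨v, hv⟩ : V) ∈ Metric.ball (0 : V) r := by
      rw [mem_ball_zero_iff]
      exact lt_of_le_of_lt hvr (by linarith)
    have h := interior_subset (hball this)
    rw [add_comm]
    exact h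

namespace HasRelBall

variable {X : Set E} {V : Submodule ℝ E} {z : E} {r : ℝ}

theorem combo (hX : Convex ℝ X) (h : HasRelBall X V z r) {x₀ : E} (hx₀ : x₀ ∈ X) {s : ℝ}
    (hs0 : 0 < s) (hs1 : s ≤ 1) : HasRelBall X V ((1 - s) • x₀ + s • z) (s * r) := by
  refine ⟨fun x hx => ?_, fun v hv hvr => ?_⟩
  · have : x - ((1 - s) • x₀ + s • z) = (x - z) - (1 - s) • (x₀ - z) := by module
    rw [this]
    exact V.sub_mem (h.1 x hx) (V.smul_mem _ (h.1 x₀ hx₀))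
  · have h1 : z + s⁻¹ • v ∈ X := by
      refine h.2 _ (V.smul_mem _ hv) ?_
      rw [norm_smul, Real.norm_of_nonneg (by positivity), inv_mul_le_iff₀ hs0]
      exact hvr
    have h2 := hX hx₀ h1 (show 0 ≤ 1 - s by linarith) hs0.le (by ring)
    rwa [smul_add, smul_inv_smul₀ hs0.ne', ← add_assoc] at h2

/-- A convex function is continuous on the shrinkings of its domain towards a relative interior
point. -/
theorem continuousOn_image [FiniteDimensional ℝ E] (hX : Convex ℝ X) (h : HasRelBall X V z r)
    (hr : 0 < r) {f : E → ℝ}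
    (hf : ConvexOn ℝ X f) {t : ℝ} (ht0 : 0 < t) (ht1 : t ≤ 1) :
    ContinuousOn f ((fun x => (1 - t) • x + t • z) '' X) := by
  -- Pulled back to V, the shrunk set lies in the interior of the domain, where finite-dimensional
  -- convex functions are continuous.
  let Y : Set V := {v | z + (v : E) ∈ X}
  have hY : ConvexOn ℝ Y fun v : V => f (z + v) := by
    have hcomb : ∀ (u v : V) (a b : ℝ), a + b = 1 →
        z + ((a • u + b • v : V) : E) = a • (z + (u : E)) + b • (z + (v : E)) := by
      intro u v a b hab
      have : z = (a + b) • z := by rw [hab, one_smul]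
      rw [Submodule.coe_add, Submodule.coe_smul, Submodule.coe_smul]
      nth_rewrite 1 [this]
      module
    refine ⟨fun u hu v hv a b ha hb hab => ?_, fun u hu v hv a b ha hb hab => ?_⟩
    · change z + ((a • u + b • v : V) : E) ∈ X
      rw [hcomb u v a b hab]
      exact hX hu hv ha hb hab
    · simp only [hcomb u v a b hab]
      exact hf.2 hu hv ha hb hab
  have hmem : ∀ p ∈ (fun x => (1 - t) • x + t • z) '' X, p - z ∈ V := by
    rintro _ ⟨x, hx, rfl⟩
    have : (1 - t) • x + t • z - z = (1 - t) • (x - z) := by module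
    simp only [this]
    exact V.smul_mem _ (h.1 x hx)
  have hint : ∀ p (hp : p ∈ (fun x => (1 - t) • x + t • z) '' X),
      (⟨p - z, hmem p hp⟩ : V) ∈ interior Y := by
    intro p hp
    obtain ⟨x, hx, rfl⟩ := id hp
    refine mem_interior_iff_mem_nhds.2 (Metric.mem_nhds_iff.2 ⟨t * r, by positivity, fun u hu => ?_⟩)
    rw [Metric.mem_ball, dist_eq_norm] at hu
    have hu' : ‖((u - ⟨_, hmem _ hp⟩ : V) : E)‖ ≤ t * r := hu.le
    have hc := (h.combo hX hx ht0 ht1).2 _ (Submodule.coe_mem _) hu'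
    change z + (u : E) ∈ X
    convert hc using 1
    rw [Submodule.coe_sub]
    change _ = _ + ((u : E) - ((1 - t) • x + t • z - z))
    abel
  rw [continuousOn_iff_continuous_domRestrict]
  have hc : Continuous fun p : ((fun x => (1 - t) • x + t • z) '' X : Set E) =>
      (⟨⟨(p : E) - z, hmem p p.2⟩, hint p p.2⟩ : interior Y) := by fun_prop
  have := hY.continuousOn_interior.domRestrict.comp hc
  refine this.congr fun p => ?_
  simp

/-- No semicontinuity at the boundary is available. Instead, z lies between x and y = z - κ(x - z),
a point of a compact shrunk copy of X on which f is at most M. Convexity at z then bounds f x from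
below. -/
theorem exists_forall_le [FiniteDimensional ℝ E] (hX : Convex ℝ X) (hXc : IsCompact X)
    (h : HasRelBall X V z r)
    (hr : 0 < r) {f : E → ℝ} (hf : ConvexOn ℝ X f) : ∃ m : ℝ, ∀ x ∈ X, m ≤ f x := by
  have hz : z ∈ X := by simpa using h.2 0 V.zero_mem (by simpa using hr.le)
  have hc := h.continuousOn_image hX hr hf (t := 1 / 2) (by norm_num) (by norm_num)
  have hK : IsCompact ((fun x => ((1 : ℝ) - 1 / 2) • x + ((1 : ℝ) / 2) • z) '' X) :=
    hXc.image (by fun_prop)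
  obtain ⟨M, hM⟩ := hK.exists_bound_of_continuousOn hc
  obtain ⟨R, hR⟩ := hXc.isBounded.exists_norm_le
  set κ : ℝ := r / (4 * (|R| + 1)) with hκ
  have hκ0 : 0 < κ := by positivity
  refine ⟨((1 + κ) * f z - M) / κ, fun x hx => ?_⟩
  have hxz : ‖x - z‖ ≤ 2 * (|R| + 1) := by
    have h1 := norm_sub_le x z
    have h2 := (hR x hx).trans (le_abs_self R)
    have h3 := (hR z hz).trans (le_abs_self R)
    linarith
  have hy : z + (-(2 * κ)) • (x - z) ∈ X := by
    refine h.2 _ (V.smul_mem _ (h.1 x hx)) ?_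
    rw [norm_smul, norm_neg, Real.norm_of_nonneg (by positivity)]
    calc 2 * κ * ‖x - z‖ ≤ 2 * κ * (2 * (|R| + 1)) := by gcongr
      _ = r := by rw [hκ]; field_simp; norm_num
  have hyK := hM _ (Set.mem_image_of_mem _ hy)
  set y := ((1 : ℝ) - 1 / 2) • (z + (-(2 * κ)) • (x - z)) + ((1 : ℝ) / 2) • z with hy_def
  have hyX : y ∈ X := hX hy hz (by norm_num) (by norm_num) (by norm_num)
  have hzeq : z = (1 / (1 + κ)) • y + (κ / (1 + κ)) • x := by
    have hne : (1 : ℝ) + κ ≠ 0 := by positivity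
    have : y = z - κ • (x - z) := by rw [hy_def]; module
    rw [this]
    have h1 : (1 / (1 + κ)) • (z - κ • (x - z)) + (κ / (1 + κ)) • x =
        ((1 / (1 + κ)) * (1 + κ)) • z := by
      rw [show κ / (1 + κ) = (1 / (1 + κ)) * κ by ring]; module
    rw [h1, one_div_mul_cancel hne, one_smul]
  have hfz := hf.2 hyX hx (show 0 ≤ 1 / (1 + κ) by positivity)
    (show 0 ≤ κ / (1 + κ) by positivity)
    (by field_simp)
  rw [← hzeq] at hfz
  simp only [smul_eq_mul] at hfz
  have hfy : f y ≤ M := (le_abs_self _).trans hyK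
  have h2 : (1 + κ) * f z ≤ f y + κ * f x := by
    have := mul_le_mul_of_nonneg_left hfz (show 0 ≤ 1 + κ by positivity)
    have e : (1 + κ) * (1 / (1 + κ) * f y + κ / (1 + κ) * f x) = f y + κ * f x := by field_simp
    rwa [e] at this
  rw [div_le_iff₀ hκ0]
  linarith

end HasRelBall

/-- Lagrange multipliers for finitely many convex constraints with a Slater point. -/
theorem exists_lagrange_multiplier {ι : Type*} [Fintype ι] {X : Set E} {g : E → ℝ}
    {f : ι → E → ℝ} (hg : ConvexOn ℝ X g) (hf : ∀ i, ConvexOn ℝ X (f i)) {x₀ : E} (hx₀ : x₀ ∈ X)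
    (hfx₀ : ∀ i, f i x₀ < 0) {J : ℝ} (hJ : ∀ x ∈ X, (∀ i, f i x ≤ 0) → J ≤ g x) :
    ∃ μ : ι → ℝ, (∀ i, 0 ≤ μ i) ∧ ∀ x ∈ X, J ≤ g x + ∑ i, μ i * f i x := by
  classical
  -- With strict inequalities A is open, so it can be separated from (0, J) without any continuity
  -- of f or g.
  let A : Set ((ι → ℝ) × ℝ) := {p | ∃ x ∈ X, (∀ i, f i x < p.1 i) ∧ g x < p.2}
  have hAc : Convex ℝ A := by
    rintro p ⟨x, hx, hxf, hxg⟩ q ⟨y, hy, hyf, hyg⟩ a b ha hb hab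
    have hcomb : ∀ {u v u' v' : ℝ}, u < u' → v < v' → a * u + b * v < a * u' + b * v' := by
      intro u v u' v' hu hv
      rcases ha.eq_or_lt with rfl | ha'
      · obtain rfl : b = 1 := by linarith
        linarith
      · nlinarith [mul_lt_mul_of_pos_left hu ha', mul_le_mul_of_nonneg_left hv.le hb]
    refine ⟨a • x + b • y, hg.1 hx hy ha hb hab, fun i => ?_, ?_⟩
    · exact ((hf i).2 hx hy ha hb hab).trans_lt (hcomb (hxf i) (hyf i))
    · exact (hg.2 hx hy ha hb hab).trans_lt (hcomb hxg hyg)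
  have hAo : IsOpen A := by
    have : A = ⋃ x ∈ X, ((⋂ i, {p : (ι → ℝ) × ℝ | f i x < p.1 i}) ∩ {p | g x < p.2}) := by
      ext p
      simp only [A, Set.mem_ofPred_eq, Set.mem_iUnion, Set.mem_inter_iff, Set.mem_iInter, exists_prop]
    rw [this]
    refine isOpen_biUnion fun x _ => (isOpen_iInter_of_finite fun i => ?_).inter
      (isOpen_lt continuous_const continuous_snd)
    exact isOpen_lt continuous_const (by fun_prop)
  have hJA : ((0 : ι → ℝ), J) ∉ A := by
    rintro ⟨x, hx, hxf, hxg⟩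
    exact absurd (hJ x hx fun i => (hxf i).le) (not_le.2 hxg)
  obtain ⟨L, hL⟩ := geometric_hahn_banach_open_point hAc hAo hJA
  let μ : ι → ℝ := fun i => -L (Pi.single i 1, 0)
  let ν : ℝ := -L (0, 1)
  have hLf : ∀ (u : ι → ℝ) (r : ℝ), L (u, r) = -(∑ i, μ i * u i + ν * r) := fun u r => by
    have h1 : (u, r) = ∑ i, u i • ((Pi.single i (1 : ℝ) : ι → ℝ), (0 : ℝ)) +
        r • ((0 : ι → ℝ), (1 : ℝ)) := by
      refine Prod.ext ?_ ?_
      · simp only [Prod.fst_add, Prod.fst_sum, Prod.smul_fst, smul_zero, add_zero]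
        exact pi_eq_sum_univ' u |>.trans (Finset.sum_congr rfl fun i _ => by
          congr 1)
      · simp [Prod.snd_sum]
    rw [h1, map_add, map_sum]
    simp only [map_smul, smul_eq_mul, μ, ν, neg_mul, Finset.sum_neg_distrib]
    rw [← neg_add, neg_neg, mul_comm r]
    congr 1
    exact Finset.sum_congr rfl fun i _ => mul_comm _ _
  have hpos : ∀ x ∈ X, ∀ (u : ι → ℝ) (r : ℝ), (∀ i, f i x < u i) → g x < r →
      ν * J < ∑ i, μ i * u i + ν * r := fun x hx u r hu hr => by
    have := hL (u, r) ⟨x, hx, hu, hr⟩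
    rw [hLf, hLf] at this
    simp only [Pi.zero_apply, mul_zero, Finset.sum_const_zero, zero_add] at this
    linarith
  have hlin : ∀ {a b m : ℝ}, (∀ s : ℝ, 0 ≤ s → a < b + m * s) → 0 ≤ m := by
    intro a b m h
    by_contra! hm
    have h0 := h 0 le_rfl
    have := h ((b - a) / (-m)) (div_nonneg (by linarith) (by linarith))
    have e : m * ((b - a) / (-m)) = -(b - a) := by field_simp [hm.ne]
    rw [e] at this
    linarith
  have hμ : ∀ i, 0 ≤ μ i := fun i => by
    refine hlin (a := ν * J) (b := ∑ j, μ j * (f j x₀ + 1) + ν * (g x₀ + 1)) fun s hs => ?_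
    have := hpos x₀ hx₀ (fun j => f j x₀ + 1 + (Pi.single i s : ι → ℝ) j) (g x₀ + 1) (fun j => by
      have : 0 ≤ (Pi.single i s : ι → ℝ) j := by
        by_cases hj : j = i
        · subst hj; simpa using hs
        · simp [hj]
      linarith) (by linarith)
    simp only [mul_add, Finset.sum_add_distrib] at this ⊢
    have e : ∑ j, μ j * (Pi.single i s : ι → ℝ) j = μ i * s := by
      rw [Finset.sum_eq_single i] <;> simp +contextual
    rw [e] at this
    linarith
  have hν : 0 ≤ ν := by
    refine hlin (a := ν * J) (b := ∑ j, μ j * (f j x₀ + 1) + ν * (g x₀ + 1)) fun s hs => ?_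
    have := hpos x₀ hx₀ (fun j => f j x₀ + 1) (g x₀ + 1 + s) (fun j => by linarith) (by linarith)
    linarith
  have hweak : ∀ x ∈ X, ν * J ≤ ∑ i, μ i * f i x + ν * g x := fun x hx => by
    refine le_of_forall_pos_le_add fun δ hδ => ?_
    have hS : 0 ≤ ∑ i, μ i + ν := add_nonneg (Finset.sum_nonneg fun i _ => hμ i) hν
    set η := δ / (∑ i, μ i + ν + 1)
    have hη : 0 < η := by positivity
    have := hpos x hx (fun i => f i x + η) (g x + η) (fun i => by linarith) (by linarith)
    simp only [mul_add, Finset.sum_add_distrib, ← Finset.sum_mul] at this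
    have h2 : (∑ i, μ i + ν) * η ≤ δ := by
      have : δ = (∑ i, μ i + ν + 1) * η := by simp only [η]; field_simp
      nlinarith
    linarith
  -- If ν = 0, the Slater point forces every μ i to vanish, against strict separation.
  have hν0 : 0 < ν := by
    refine lt_of_le_of_ne hν fun h0 => ?_
    have h1 := hweak x₀ hx₀
    rw [← h0] at h1
    have hle : ∀ i ∈ Finset.univ, μ i * f i x₀ ≤ 0 := fun i _ =>
      mul_nonpos_of_nonneg_of_nonpos (hμ i) (hfx₀ i).le
    have hsum : ∑ i, μ i * f i x₀ = 0 := le_antisymm (Finset.sum_nonpos hle) (by linarith)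
    have hz : ∀ i, μ i = 0 := fun i => by
      have := (Finset.sum_eq_zero_iff_of_nonpos hle).1 hsum i (Finset.mem_univ i)
      exact (mul_eq_zero.1 this).resolve_right (hfx₀ i).ne
    have := hpos x₀ hx₀ (fun j => f j x₀ + 1) (g x₀ + 1) (fun j => by linarith) (by linarith)
    simp [hz, ← h0] at this
  refine ⟨fun i => μ i / ν, fun i => div_nonneg (hμ i) hν, fun x hx => ?_⟩
  have h := hweak x hx
  have e : ∑ i, μ i / ν * f i x = (∑ i, μ i * f i x) / ν := by
    rw [Finset.sum_div]
    exact Finset.sum_congr rfl fun i _ => by ring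
  rw [e, ← sub_le_iff_le_add', le_div_iff₀ hν0]
  linarith

end Convex

end

/-! ### Deterministic estimates on optimal values. -/

noncomputable section

section OptValue

variable {n : ℕ} {c : EuclideanSpace ℝ (Fin n)} {S T : Set (EuclideanSpace ℝ (Fin n))}

theorem optValue_le (hS : BddBelow ((fun x => inner ℝ c x) '' S)) {x : EuclideanSpace ℝ (Fin n)}
    (hx : x ∈ S) : optValue c S ≤ inner ℝ c x :=
  csInf_le hS (Set.mem_image_of_mem _ hx)

theorem le_optValue (hS : S.Nonempty) {a : ℝ} (h : ∀ x ∈ S, a ≤ inner ℝ c x) :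
    a ≤ optValue c S :=
  le_csInf (hS.image _) (by rintro _ ⟨x, hx, rfl⟩; exact h x hx)

theorem optValue_anti (hT : BddBelow ((fun x => inner ℝ c x) '' T)) (hS : S.Nonempty)
    (h : S ⊆ T) : optValue c T ≤ optValue c S :=
  le_optValue hS fun _ hx => optValue_le hT (h hx)

end OptValue

namespace UncertainProgram

variable {n : ℕ} {D : Type*} [MeasurableSpace D] (U : UncertainProgram n D)
  {c x₀ : EuclideanSpace ℝ (Fin n)} {P : Measure D}

theorem isCompact_image_inner (c : EuclideanSpace ℝ (Fin n)) :
    IsCompact ((fun x => inner ℝ c x) '' U.X) :=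
  U.isCompact_X.image (by fun_prop)

theorem bddBelow_image_inner (c : EuclideanSpace ℝ (Fin n)) {S : Set (EuclideanSpace ℝ (Fin n))}
    (hS : S ⊆ U.X) : BddBelow ((fun x => inner ℝ c x) '' S) :=
  (U.isCompact_image_inner c).bddBelow.mono (Set.image_mono hS)

theorem le_objRange {x y : EuclideanSpace ℝ (Fin n)} (hx : x ∈ U.X) (hy : y ∈ U.X) :
    inner ℝ c x - inner ℝ c y ≤ U.objRange c :=
  sub_le_sub (le_csSup (U.isCompact_image_inner c).bddAbove (Set.mem_image_of_mem _ hx))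
    (optValue_le (U.bddBelow_image_inner c subset_rfl) hy)

theorem measurable_f_right {x : EuclideanSpace ℝ (Fin n)} (hx : x ∈ U.X) : Measurable (U.f x) :=
  U.measurable_f.comp (measurable_prodMk_left (x := (⟨x, hx⟩ : U.X)))

theorem bddAbove_range {x : EuclideanSpace ℝ (Fin n)} (hx : x ∈ U.X) :
    BddAbove (Set.range (U.f x)) := by
  obtain ⟨M, hM⟩ := U.bounded_f x hx
  exact ⟨M, by rintro _ ⟨d, rfl⟩; exact (abs_le.1 (hM d)).2⟩

theorem f_le_iSup {x : EuclideanSpace ℝ (Fin n)} (hx : x ∈ U.X) (d : D) :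
    U.f x d ≤ ⨆ v, U.f x v :=
  le_ciSup (U.bddAbove_range hx) d

theorem robust_subset_scenario {N : ℕ} (d : Fin N → D) : U.robust ⊆ U.scenario d :=
  fun _ hx => ⟨hx.1, fun _ => hx.2 _⟩

theorem robust_subset_chance [IsProbabilityMeasure P] {ε : ℝ} (hε : 0 ≤ ε) :
    U.robust ⊆ U.chance P ε := fun x hx => by
  refine ⟨hx.1, ?_⟩
  have : {d | U.f x d ≤ 0} = Set.univ := Set.eq_univ_of_forall hx.2
  rw [this, probReal_univ]
  linarith

variable {U}

theorem IsSlater.mem_robust (h : U.IsSlater x₀) : x₀ ∈ U.robust :=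
  ⟨h.1, fun d => (U.f_le_iSup h.1 d).trans h.2.le⟩

theorem IsSlater.slaterConst_nonneg (h : U.IsSlater x₀) : 0 ≤ U.slaterConst c x₀ :=
  div_nonneg_of_nonpos (sub_nonpos.2 (optValue_le (U.bddBelow_image_inner c subset_rfl) h.1)) h.2.le

theorem le_combo_of_le {x y : EuclideanSpace ℝ (Fin n)} (hx : x ∈ U.X) (hy : y ∈ U.X) {a s t : ℝ}
    (ha0 : 0 ≤ a) (ha1 : a ≤ 1) {d : D} (hs : U.f x d ≤ s) (ht : U.f y d ≤ t) :
    U.f ((1 - a) • x + a • y) d ≤ (1 - a) * s + a * t := by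
  have := (U.convexOn_f d).2 hx hy (show 0 ≤ 1 - a by linarith) ha0 (by ring)
  simp only [smul_eq_mul] at this
  exact this.trans (add_le_add (mul_le_mul_of_nonneg_left hs (by linarith))
    (mul_le_mul_of_nonneg_left ht ha0))

/-- Mixing with a Slater point restores robust feasibility at a cost proportional to the
violation. -/
theorem IsSlater.exists_robust_inner_le (h : U.IsSlater x₀) {x : EuclideanSpace ℝ (Fin n)}
    (hx : x ∈ U.X) {s : ℝ} (hs : 0 ≤ s) (hxs : ∀ d, U.f x d ≤ s) :
    ∃ y ∈ U.robust, inner ℝ c y - inner ℝ c x ≤ U.slaterConst c x₀ * s := by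
  set s₀ := ⨆ d, U.f x₀ d with hs₀
  have hs₀neg : s₀ < 0 := h.2
  have hd : 0 < s - s₀ := by linarith
  -- The weight for which (1 - a) s + a s₀ = 0.
  set a := s / (s - s₀) with ha
  have ha0 : 0 ≤ a := div_nonneg hs hd.le
  have ha1 : a ≤ 1 := (div_le_one hd).2 (by linarith)
  have hmul : a * (s - s₀) = s := div_mul_cancel₀ _ hd.ne'
  refine ⟨(1 - a) • x + a • x₀, ⟨U.convex_X hx h.1 (by linarith) ha0 (by ring), fun d => ?_⟩, ?_⟩
  · refine (le_combo_of_le hx h.1 ha0 ha1 (hxs d) (U.f_le_iSup h.1 d)).trans (le_of_eq ?_)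
    rw [← hs₀]
    linarith
  · rw [inner_add_right, inner_smul_right, inner_smul_right]
    have h1 : optValue c U.X ≤ inner ℝ c x := optValue_le (U.bddBelow_image_inner c subset_rfl) hx
    have h2 : optValue c U.X ≤ inner ℝ c x₀ :=
      optValue_le (U.bddBelow_image_inner c subset_rfl) h.1
    have h3 : a ≤ s / (-s₀) := div_le_div_of_nonneg_left hs (by linarith) (by linarith)
    have h4 : U.slaterConst c x₀ * s = s / (-s₀) * (inner ℝ c x₀ - optValue c U.X) := by
      rw [slaterConst, ← hs₀]
      have := hs₀neg.ne
      field_simp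
      ring
    rw [h4]
    calc (1 - a) * inner ℝ c x + a * inner ℝ c x₀ - inner ℝ c x
        = a * (inner ℝ c x₀ - inner ℝ c x) := by ring
      _ ≤ a * (inner ℝ c x₀ - optValue c U.X) := mul_le_mul_of_nonneg_left (by linarith) ha0
      _ ≤ s / (-s₀) * (inner ℝ c x₀ - optValue c U.X) :=
        mul_le_mul_of_nonneg_right h3 (by linarith)

/-- The worst-case violation at a point of the chance-constrained set is controlled by the uniform
level-set bound. -/
theorem IsULB.exists_le_of_mem_chance [IsProbabilityMeasure P] {h : ℝ → ℝ≥0∞} (hh : U.IsULB P h)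
    {ε : ℝ} (hε : ε ∈ Set.Icc (0 : ℝ) 1) {x : EuclideanSpace ℝ (Fin n)}
    (hx : x ∈ U.chance P ε) : ∃ s : ℝ≥0, (∀ d, U.f x d ≤ s) ∧ (s : ℝ≥0∞) ≤ h ε := by
  set S := ⨆ v, U.f x v with hS
  rcases le_or_gt S 0 with h0 | h0
  · exact ⟨0, fun d => (U.f_le_iSup hx.1 d).trans h0, zero_le⟩
  -- With δ = S the tail probability at x is the violation probability, hence at most ε.
  · refine ⟨⟨S, h0.le⟩, fun d => U.f_le_iSup hx.1 d, le_trans (le_sSup ?_) (hh ε hε)⟩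
    refine ⟨⟨S, h0.le⟩, rfl, (iInf₂_le x hx.1).trans ?_⟩
    have hm : MeasurableSet {d | U.f x d ≤ 0} :=
      measurableSet_le (U.measurable_f_right hx.1) measurable_const
    have hset : {d | (⨆ v, U.f x v) - ((⟨S, h0.le⟩ : ℝ≥0) : ℝ) < U.f x d} = {d | U.f x d ≤ 0}ᶜ := by
      ext d
      simp [← hS]
    change P {d | (⨆ v, U.f x v) - ((⟨S, h0.le⟩ : ℝ≥0) : ℝ) < U.f x d} ≤ _
    rw [hset]
    have h1 := probReal_compl_eq_one_sub (μ := P) hm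
    have h2 : P.real {d | U.f x d ≤ 0}ᶜ ≤ ε := by linarith [hx.2]
    exact (ENNReal.le_ofReal_iff_toReal_le (measure_ne_top _ _) hε.1).2 h2

/-- The finite s stands in for h, which may be ∞; the minimum with the objective range stays finite,
so `toReal` loses nothing. -/
theorem le_intervalLength {L y : ℝ} (hL : 0 ≤ L) {s : ℝ≥0} {h : ℝ≥0∞} (hs : (s : ℝ≥0∞) ≤ h)
    (hy : y ≤ L * s) (hyR : y ≤ U.objRange c) : y ≤ U.intervalLength c L h := by
  refine (ENNReal.ofReal_le_iff_le_toReal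
    (ne_top_of_le_ne_top ENNReal.ofReal_ne_top (min_le_right _ _))).1 (le_min ?_ ?_)
  · refine (ENNReal.ofReal_le_ofReal hy).trans ?_
    rw [ENNReal.ofReal_mul hL, ENNReal.ofReal_coe_nnreal]
    gcongr
  · exact ENNReal.ofReal_le_ofReal hyR

theorem optValue_robust_le_of_mem_chance [IsProbabilityMeasure P] (h₀ : U.IsSlater x₀)
    {h : ℝ → ℝ≥0∞} (hh : U.IsULB P h) {ε : ℝ} (hε : ε ∈ Set.Icc (0 : ℝ) 1)
    {x : EuclideanSpace ℝ (Fin n)} (hx : x ∈ U.chance P ε) :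
    optValue c U.robust ≤ inner ℝ c x + U.aPriori c x₀ h ε := by
  obtain ⟨s, hs, hsh⟩ := hh.exists_le_of_mem_chance hε hx
  obtain ⟨y, hy, hyx⟩ := h₀.exists_robust_inner_le (c := c) hx.1 s.2 hs
  have h1 : optValue c U.robust ≤ inner ℝ c y :=
    optValue_le (U.bddBelow_image_inner c fun _ h => h.1) hy
  have h2 : inner ℝ c y - inner ℝ c x ≤ U.aPriori c x₀ h ε :=
    le_intervalLength h₀.slaterConst_nonneg hsh hyx (U.le_objRange hy.1 hx.1)
  linarith

theorem exists_forall_le_f (hne : U.X.Nonempty) {g : EuclideanSpace ℝ (Fin n) → ℝ}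
    (hg : ConvexOn ℝ U.X g) : ∃ m : ℝ, ∀ x ∈ U.X, m ≤ g x := by
  obtain ⟨z, -, V, r, hr, h⟩ := exists_hasRelBall U.convex_X hne
  exact h.exists_forall_le U.convex_X U.isCompact_X hr hg

theorem convexOn_inner (U : UncertainProgram n D) (c : EuclideanSpace ℝ (Fin n)) :
    ConvexOn ℝ U.X fun x => inner ℝ c x :=
  ⟨U.convex_X, fun x _ y _ a b _ _ _ => by
    simp [inner_add_right, inner_smul_right]⟩

theorem convexOn_lagrangian (U : UncertainProgram n D) (c : EuclideanSpace ℝ (Fin n)) {N : ℕ}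
    (d : Fin N → D) {lam : Fin N → ℝ} (hlam : ∀ i, 0 ≤ lam i) :
    ConvexOn ℝ U.X fun x => inner ℝ c x + ∑ i, lam i * U.f x (d i) := by
  refine (U.convexOn_inner c).add ?_
  have := Finset.sum_induction (s := Finset.univ) (fun i => fun x => lam i * U.f x (d i))
    (fun g => ConvexOn ℝ U.X g) (fun _ _ h1 h2 => h1.add h2) (convexOn_const 0 U.convex_X)
    fun i _ => (U.convexOn_f (d i)).smul (hlam i)
  have e : (fun x => ∑ i, lam i * U.f x (d i)) = ∑ i, fun x => lam i * U.f x (d i) := by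
    ext x; simp
  rw [e]
  exact this

/-- Strong duality for the scenario program. -/
theorem IsDualOptimizer.optValue_scenario_le (h₀ : U.IsSlater x₀) {N : ℕ} {d : Fin N → D}
    {lam : Fin N → ℝ} (h : U.IsDualOptimizer c d lam) {x : EuclideanSpace ℝ (Fin n)}
    (hx : x ∈ U.X) : optValue c (U.scenario d) ≤ inner ℝ c x + ∑ i, lam i * U.f x (d i) := by
  obtain ⟨μ, hμ, hμx⟩ := exists_lagrange_multiplier (U.convexOn_inner c)
    (f := fun i x => U.f x (d i)) (fun i => U.convexOn_f (d i)) h₀.1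
    (fun i => (U.f_le_iSup h₀.1 (d i)).trans_lt h₀.2) (J := optValue c (U.scenario d))
    fun y hy hyf => optValue_le (U.bddBelow_image_inner c fun _ h => h.1) ⟨hy, hyf⟩
  have hne : U.X.Nonempty := ⟨_, hx⟩
  have h1 : optValue c (U.scenario d) ≤ U.dualFun c d μ :=
    le_csInf (hne.image _) (by rintro _ ⟨y, hy, rfl⟩; exact hμx y hy)
  -- A real `sInf` is a lower bound only for sets bounded below, so the Lagrangian needs one on X.
  obtain ⟨m, hm⟩ := exists_forall_le_f hne (U.convexOn_lagrangian c d h.1)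
  have h2 : U.dualFun c d lam ≤ inner ℝ c x + ∑ i, lam i * U.f x (d i) :=
    csInf_le ⟨m, by rintro _ ⟨y, hy, rfl⟩; exact hm y hy⟩ ⟨x, hx, rfl⟩
  exact h1.trans ((h.2 μ hμ).trans h2)

/-- Strong duality at x gives the multiplier bound; scenario feasibility of x₀ gives the bound by
the objective range. -/
theorem optValue_scenario_le_of_mem_chance [IsProbabilityMeasure P] (h₀ : U.IsSlater x₀)
    {h : ℝ → ℝ≥0∞} (hh : U.IsULB P h) {ε : ℝ} (hε : ε ∈ Set.Icc (0 : ℝ) 1) {N : ℕ}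
    {d : Fin N → D} {lam : Fin N → ℝ} (hlam : U.IsDualOptimizer c d lam)
    {x : EuclideanSpace ℝ (Fin n)} (hx : x ∈ U.chance P ε) :
    optValue c (U.scenario d) ≤ inner ℝ c x + U.aPosteriori c lam h ε := by
  obtain ⟨s, hs, hsh⟩ := hh.exists_le_of_mem_chance hε hx
  have h1 := hlam.optValue_scenario_le h₀ hx.1
  have h2 : ∑ i, lam i * U.f x (d i) ≤ (∑ i, |lam i|) * s := by
    rw [Finset.sum_mul]
    exact Finset.sum_le_sum fun i _ => by
      rw [abs_of_nonneg (hlam.1 i)]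
      exact mul_le_mul_of_nonneg_left (hs _) (hlam.1 i)
  have h3 : optValue c (U.scenario d) ≤ inner ℝ c x₀ :=
    optValue_le (U.bddBelow_image_inner c fun _ h => h.1)
      (U.robust_subset_scenario d h₀.mem_robust)
  have h4 := U.le_objRange (c := c) h₀.1 hx.1
  have h5 : optValue c (U.scenario d) - inner ℝ c x ≤ U.aPosteriori c lam h ε :=
    le_intervalLength (Finset.sum_nonneg fun i _ => abs_nonneg _) hsh (by linarith) (by linarith)
  linarith

end UncertainProgram

end

/-! ### Perturbation to a nondegenerate program. -/

noncomputable section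

namespace UncertainProgram

variable {n : ℕ} {D : Type*} [MeasurableSpace D] {U : UncertainProgram n D}
  {c x₀ : EuclideanSpace ℝ (Fin n)} {P : Measure D}

theorem IsSlater.exists_hasRelBall (h : U.IsSlater x₀) : ∃ x₁ ∈ U.X, ∃ γ : ℝ, 0 < γ ∧
    (∀ d, U.f x₁ d ≤ -γ) ∧ ∃ (V : Submodule ℝ (EuclideanSpace ℝ (Fin n))) (r : ℝ), 0 < r ∧
      HasRelBall U.X V x₁ r := by
  obtain ⟨z, hz, V, r, hr, hV⟩ := _root_.exists_hasRelBall U.convex_X ⟨x₀, h.1⟩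
  obtain ⟨M, hM⟩ := U.bounded_f z hz
  set s₀ := ⨆ d, U.f x₀ d with hs₀
  have hs₀neg : s₀ < 0 := h.2
  have hd : 0 < |M| - s₀ := by linarith [abs_nonneg M]
  -- Mixing in a relative interior point with this weight keeps the constraint at most s₀ / 2.
  set s := (-s₀ / 2) / (|M| - s₀) with hs
  have hs0 : 0 < s := div_pos (by linarith) hd
  have hs1 : s ≤ 1 := (div_le_one hd).2 (by linarith [abs_nonneg M])
  have hmul : s * (|M| - s₀) = -s₀ / 2 := div_mul_cancel₀ _ hd.ne'
  refine ⟨(1 - s) • x₀ + s • z, U.convex_X h.1 hz (by linarith) hs0.le (by ring), -s₀ / 2,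
    by linarith, fun d => ?_, V, s * r, by positivity, hV.combo U.convex_X h.1 hs0 hs1⟩
  refine (le_combo_of_le h.1 hz hs0.le hs1 (U.f_le_iSup h.1 d)
    ((le_abs_self _).trans ((hM d).trans (le_abs_self M)))).trans (le_of_eq ?_)
  rw [← hs₀]
  linarith

theorem shrink_subset {x₁ : EuclideanSpace ℝ (Fin n)} (hx₁ : x₁ ∈ U.X) {t : ℝ} (ht0 : 0 < t)
    (ht1 : t ≤ 1) : (fun x => (1 - t) • x + t • x₁) '' U.X ⊆ U.X := by
  rintro _ ⟨x, hx, rfl⟩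
  exact U.convex_X hx hx₁ (by linarith) ht0.le (by ring)

/-- The program with decision set shrunk towards `x₁`, a strictly convex objective, and constraints
`f x d ≤ ρ z` relaxed by a random amount `z`. -/
def perturbed (U : UncertainProgram n D) (c : EuclideanSpace ℝ (Fin n))
    {x₁ : EuclideanSpace ℝ (Fin n)} (hx₁ : x₁ ∈ U.X)
    (hf₁ : ∀ d, U.f x₁ d ≤ 0) {V : Submodule ℝ (EuclideanSpace ℝ (Fin n))} {r : ℝ} (hr : 0 < r)
    (hV : HasRelBall U.X V x₁ r) {φ : EuclideanSpace ℝ (Fin n) → ℝ}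
    (hφ : StrictConvexOn ℝ Set.univ φ) {t : ℝ} (ht0 : 0 < t) (ht1 : t ≤ 1) {η : ℝ} (hη : 0 < η)
    {ρ : ℝ} (hρ : 0 < ρ) : ConstraintFamily (EuclideanSpace ℝ (Fin n)) (D × unitInterval) where
  K := (fun x => (1 - t) • x + t • x₁) '' U.X
  g := fun x => inner ℝ c x + η * φ x
  F := fun x w => U.f x w.1 - ρ * w.2
  isCompact_K := U.isCompact_X.image (by fun_prop)
  strictConvexOn_g := by
    have hK : Convex ℝ ((fun x => (1 - t) • x + t • x₁) '' U.X) := by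
      rintro _ ⟨x, hx, rfl⟩ _ ⟨y, hy, rfl⟩ a b ha hb hab
      refine ⟨a • x + b • y, U.convex_X hx hy ha hb hab, ?_⟩
      have : x₁ = (a + b) • x₁ := by rw [hab, one_smul]
      simp only
      nth_rewrite 1 [this]
      module
    refine ⟨hK, fun x _ y _ hxy a b ha hb hab => ?_⟩
    have := mul_lt_mul_of_pos_left (hφ.2 (Set.mem_univ x) (Set.mem_univ y) hxy ha hb hab) hη
    simp only [smul_eq_mul, inner_add_right, inner_smul_right] at this ⊢
    linarith
  continuousOn_g := by
    have : Continuous φ := continuousOn_univ.1 (hφ.convexOn.continuousOn isOpen_univ)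
    fun_prop
  convexOn_F := fun w => by
    have h1 := (U.convexOn_f w.1).subset (shrink_subset hx₁ ht0 ht1) (by
      rintro _ ⟨x, hx, rfl⟩ _ ⟨y, hy, rfl⟩ a b ha hb hab
      refine ⟨a • x + b • y, U.convex_X hx hy ha hb hab, ?_⟩
      have : x₁ = (a + b) • x₁ := by rw [hab, one_smul]
      simp only
      nth_rewrite 1 [this]
      module)
    exact h1.sub (concaveOn_const _ h1.1)
  continuousOn_F := fun w =>
    (hV.continuousOn_image U.convex_X hr (U.convexOn_f w.1) ht0 ht1).sub continuousOn_const
  measurable_F := by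
    have h1 : Measurable fun z : ((fun x => (1 - t) • x + t • x₁) '' U.X : Set _) ×
        (D × unitInterval) => ((⟨z.1, shrink_subset hx₁ ht0 ht1 z.1.2⟩ : U.X), z.2.1) :=
      (Measurable.subtype_mk (measurable_subtype_coe.comp measurable_fst)).prodMk
        (measurable_fst.comp measurable_snd)
    exact (U.measurable_f.comp h1).sub
      ((measurable_subtype_coe.comp (measurable_snd.comp measurable_snd)).const_mul ρ)
  exists_feasible := ⟨x₁, ⟨x₁, hx₁, by simp only; module⟩, fun w => by
    have := hf₁ w.1
    have := mul_nonneg hρ.le w.2.2.1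
    linarith⟩

theorem measurable_optValue_scenario (hopt : U.HasMeasurableOptimizer c) (N : ℕ) :
    Measurable fun d : Fin N → D => optValue c (U.scenario d) := by
  obtain ⟨φ, -, h⟩ := hopt
  rcases Nat.eq_zero_or_pos N with rfl | hN
  · exact Subsingleton.measurable
  obtain ⟨xs, hxs, hd⟩ := h N hN
  have : (fun d : Fin N → D => optValue c (U.scenario d)) = fun d => inner ℝ c (xs d) := by
    ext d
    exact le_antisymm (optValue_le (U.bddBelow_image_inner c fun _ h => h.1) (hd d).1)
      (le_optValue ⟨_, (hd d).1⟩ (hd d).2.1)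
  rw [this]
  fun_prop

/-- Applies the scenario bound to the perturbed program. The error κ is split evenly between
shrinking X (t), the strictly convex term (η), and the mixing with x₁ that undoes the relaxation ρ
(a). -/
theorem le_measureReal_optValue_le_add [IsProbabilityMeasure P] (hn : 0 < n)
    (hopt : U.HasMeasurableOptimizer c) (h₀ : U.IsSlater x₀) {ε : ℝ} (hε : ε ∈ Set.Icc (0 : ℝ) 1)
    (N : ℕ) {κ : ℝ} (hκ : 0 < κ) :
    1 - binomTail n N ε ≤ (Measure.pi fun _ : Fin N => P).real
      {d | optValue c (U.chance P ε) ≤ optValue c (U.scenario d) + κ} := by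
  obtain ⟨x₁, hx₁, γ, hγ, hfγ, V, r, hr, hV⟩ := h₀.exists_hasRelBall
  obtain ⟨φ, hφ, -⟩ := id hopt
  have hφc : Continuous φ := continuousOn_univ.1 (hφ.convexOn.continuousOn isOpen_univ)
  obtain ⟨Φ, hΦ⟩ := U.isCompact_X.exists_bound_of_continuousOn hφc.continuousOn
  have hΦ0 : 0 ≤ Φ := (norm_nonneg _).trans (hΦ x₁ hx₁)
  set R := U.objRange c with hR
  have hR0 : 0 ≤ R := by have := U.le_objRange (c := c) hx₁ hx₁; simpa using this
  obtain ⟨t, ht0, ht1, htR⟩ : ∃ t : ℝ, 0 < t ∧ t ≤ 1 ∧ t * R ≤ κ / 3 := by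
    refine ⟨min 1 (κ / (3 * (R + 1))), by positivity, min_le_left _ _, ?_⟩
    calc min 1 (κ / (3 * (R + 1))) * R ≤ κ / (3 * (R + 1)) * (R + 1) :=
          mul_le_mul (min_le_right _ _) (by linarith) hR0 (by positivity)
      _ = κ / 3 := by field_simp
  obtain ⟨η, hη, hηΦ⟩ : ∃ η : ℝ, 0 < η ∧ η * (2 * Φ) ≤ κ / 3 := by
    refine ⟨κ / (3 * (2 * Φ + 1)), by positivity, ?_⟩
    calc κ / (3 * (2 * Φ + 1)) * (2 * Φ) ≤ κ / (3 * (2 * Φ + 1)) * (2 * Φ + 1) :=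
          mul_le_mul_of_nonneg_left (by linarith) (by positivity)
      _ = κ / 3 := by field_simp
  obtain ⟨ρ, a, hρ, ha0, ha1, haR, haρ⟩ : ∃ ρ a : ℝ, 0 < ρ ∧ 0 ≤ a ∧ a ≤ 1 ∧ a * R ≤ κ / 3 ∧
      (1 - a) * ρ + a * (-γ) ≤ 0 := by
    have hd : 0 < 3 * (R + 1) + κ := by positivity
    refine ⟨κ / (3 * (R + 1)) * γ, κ / (3 * (R + 1) + κ), by positivity, by positivity,
      (div_le_one hd).2 (by linarith), ?_, le_of_eq ?_⟩
    · rw [div_mul_eq_mul_div, div_le_iff₀ hd]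
      nlinarith
    · field_simp
      ring
  let C := U.perturbed c hx₁ (fun d => (hfγ d).trans (by linarith)) hr hV hφ ht0 ht1 hη hρ
  let Q : Measure (D × unitInterval) := P.prod volume
  have hKX : C.K ⊆ U.X := shrink_subset hx₁ ht0 ht1
  -- For fixed d at most one relaxation z gives equality, and points are null for the uniform law.
  have hQ : ∀ x ∈ C.K, Q {b | C.F x b = 0} = 0 := fun x hx => by
    have hm : MeasurableSet {b | C.F x b = 0} :=
      measurableSet_eq_fun (C.measurable_F_right ⟨x, hx⟩) measurable_const
    refine (Measure.measure_prod_null hm).2 (.of_forall fun d => ?_)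
    refine Set.Subsingleton.measure_zero (fun z hz z' hz' => ?_) _
    have h1 : U.f x d - ρ * z = 0 := hz
    have h2 : U.f x d - ρ * z' = 0 := hz'
    exact Subtype.ext (mul_left_cancel₀ hρ.ne' (by linarith))
  have hcore := C.measureReal_satProb_lt_le Q hQ hn (by simp) hε N
  have hmp : MeasurePreserving (fun (w : Fin N → D × unitInterval) i => (w i).1)
      (Measure.pi fun _ => Q) (Measure.pi fun _ => P) :=
    measurePreserving_pi _ _ fun _ => measurePreserving_fst
  have hmeas : MeasurableSet {d : Fin N → D |
      optValue c (U.chance P ε) ≤ optValue c (U.scenario d) + κ} :=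
    measurableSet_le measurable_const ((measurable_optValue_scenario hopt N).add_const κ)
  have hbad : MeasurableSet {w : Fin N → D × unitInterval |
      (C.satProb Q (C.opt w Set.univ)).toReal < 1 - ε} :=
    measurableSet_lt ((C.measurable_satProb Q).comp (C.measurable_optK Set.univ)).ennreal_toReal
      measurable_const
  rw [← hmp.measureReal_preimage hmeas.nullMeasurableSet]
  have hcompl := probReal_compl_eq_one_sub (μ := Measure.pi fun _ : Fin N => Q) hbad
  refine le_trans ?_ (measureReal_mono (s₁ := {w : Fin N → D × unitInterval |
      (C.satProb Q (C.opt w Set.univ)).toReal < 1 - ε}ᶜ) fun w hw => ?_)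
  · rw [hcompl]; linarith
  simp only [Set.mem_compl_iff, Set.mem_ofPred_eq, not_lt] at hw
  simp only [Set.mem_preimage, Set.mem_ofPred_eq]
  set x := C.opt w Set.univ with hx
  have hxK : x ∈ C.K := C.opt_mem_K w _
  have hxX : x ∈ U.X := hKX hxK
  have hPx : 1 - ε ≤ P.real {d | U.f x d ≤ ρ} := by
    refine hw.trans (ENNReal.toReal_mono (measure_ne_top _ _) ?_)
    have : P {d | U.f x d ≤ ρ} = Q (Prod.fst ⁻¹' {d | U.f x d ≤ ρ}) :=
      (measurePreserving_fst.measure_preimage (measurableSet_le (U.measurable_f_right hxX)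
        measurable_const).nullMeasurableSet).symm
    rw [this]
    refine measure_mono fun b hb => ?_
    have h1 : U.f x b.1 - ρ * b.2 ≤ 0 := hb
    have h2 := mul_le_of_le_one_right hρ.le b.2.2.2
    change U.f x b.1 ≤ ρ
    linarith
  have hx' : (1 - a) • x + a • x₁ ∈ U.chance P ε := by
    refine ⟨U.convex_X hxX hx₁ (by linarith) ha0 (by ring), hPx.trans (measureReal_mono fun d hd => ?_)⟩
    exact (le_combo_of_le hxX hx₁ ha0 ha1 hd (hfγ d)).trans haρ
  have h1 : optValue c (U.chance P ε) ≤ inner ℝ c ((1 - a) • x + a • x₁) :=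
    optValue_le (U.bddBelow_image_inner c fun _ h => h.1) hx'
  rw [inner_add_right, inner_smul_right, inner_smul_right] at h1
  have h2 := mul_le_mul_of_nonneg_left (U.le_objRange (c := c) hx₁ hxX) ha0
  rw [← hR] at h2
  rw [← sub_le_iff_le_add]
  refine le_optValue ⟨x₀, U.robust_subset_scenario _ h₀.mem_robust⟩ fun y hy => ?_
  -- Every scenario-feasible y, once shrunk, is feasible for the perturbed program whatever the
  -- relaxations, so it competes with x.
  set y' := (1 - t) • y + t • x₁ with hy'
  have hy'K : y' ∈ C.K := ⟨y, hy.1, rfl⟩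
  have hfeas : y' ∈ C.feas w Set.univ := by
    refine ⟨hy'K, fun i _ => ?_⟩
    have h3 := le_combo_of_le hy.1 hx₁ ht0.le ht1 (hy.2 i) (hfγ (w i).1)
    have h4 : 0 ≤ ρ * (w i).2 := mul_nonneg hρ.le (w i).2.2.1
    have h5 : 0 ≤ t * γ := by positivity
    change U.f y' (w i).1 - ρ * (w i).2 ≤ 0
    rw [← hy'] at h3
    linarith
  have hg : inner ℝ c x + η * φ x ≤ inner ℝ c y' + η * φ y' := C.g_opt_le hfeas
  have h3 := abs_le.1 (hΦ x hxX)
  have h4 := abs_le.1 (hΦ y' (hKX hy'K))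
  have h5 : η * φ y' - η * φ x ≤ η * (2 * Φ) := by
    rw [← mul_sub]; exact mul_le_mul_of_nonneg_left (by linarith) hη.le
  have h6 := mul_le_mul_of_nonneg_left (U.le_objRange (c := c) hx₁ hy.1) ht0.le
  rw [← hR] at h6
  rw [hy', inner_add_right, inner_smul_right, inner_smul_right, ← hy'] at hg
  linarith

/-- With high probability, the chance-constrained optimum does not exceed the scenario optimum. -/
theorem le_measureReal_optValue_le [IsProbabilityMeasure P]
    (hopt : U.HasMeasurableOptimizer c) (h₀ : U.IsSlater x₀) {ε : ℝ} (hε : ε ∈ Set.Icc (0 : ℝ) 1)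
    (N : ℕ) : 1 - binomTail n N ε ≤ (Measure.pi fun _ : Fin N => P).real
      {d | optValue c (U.chance P ε) ≤ optValue c (U.scenario d)} := by
  -- The moment argument needs n > 0. For n = 0 there is only one point, and the event is certain.
  rcases Nat.eq_zero_or_pos n with rfl | hn
  · have : {d : Fin N → D | optValue c (U.chance P ε) ≤ optValue c (U.scenario d)} = Set.univ := by
      refine Set.eq_univ_of_forall fun d => le_optValue
        ⟨x₀, U.robust_subset_scenario d h₀.mem_robust⟩ fun y _ => ?_
      rw [Subsingleton.elim y x₀]
      exact optValue_le (U.bddBelow_image_inner c fun _ h => h.1)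
        (U.robust_subset_chance hε.1 h₀.mem_robust)
    rw [this, probReal_univ]
    linarith [binomTail_nonneg hε 0 N]
  -- Let κ = 1/(m + 1) tend to 0, by continuity of the measure from above.
  let S : ℕ → Set (Fin N → D) := fun m =>
    {d | optValue c (U.chance P ε) ≤ optValue c (U.scenario d) + 1 / ((m : ℝ) + 1)}
  have hS : ∀ m, MeasurableSet (S m) := fun m =>
    measurableSet_le measurable_const ((measurable_optValue_scenario hopt N).add_const _)
  have hanti : Antitone S := fun m m' hmm d hd => by
    have h1 : 1 / ((m' : ℝ) + 1) ≤ 1 / ((m : ℝ) + 1) := Nat.one_div_le_one_div hmm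
    simp only [S, Set.mem_ofPred_eq] at hd ⊢
    linarith
  have hinter : {d | optValue c (U.chance P ε) ≤ optValue c (U.scenario d)} = ⋂ m, S m := by
    ext d
    simp only [Set.mem_ofPred_eq, Set.mem_iInter, S]
    refine ⟨fun h m => h.trans (le_add_of_nonneg_right (by positivity)), fun h => ?_⟩
    have := (tendsto_one_div_add_atTop_nhds_zero_nat (𝕜 := ℝ)).const_add
      (optValue c (U.scenario d))
    rw [add_zero] at this
    exact ge_of_tendsto' this h
  have hlim := tendsto_measure_iInter_atTop (μ := Measure.pi fun _ : Fin N => P)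
    (fun m => (hS m).nullMeasurableSet) hanti ⟨0, measure_ne_top _ _⟩
  rw [hinter]
  refine (ENNReal.ofReal_le_iff_le_toReal (measure_ne_top _ _)).1 (ge_of_tendsto' hlim fun m => ?_)
  exact (ENNReal.ofReal_le_iff_le_toReal (measure_ne_top _ _)).2
    (le_measureReal_optValue_le_add hn hopt h₀ hε N (by positivity))

end UncertainProgram

theorem exists_le_of_sampleBound_le {n m : ℕ} {ε : Fin m → ℝ} {β : ℝ} {N : ℕ}
    (h : sampleBound n ε β ≤ (N : ℕ∞)) : ∃ M ≤ N, ∑ k, binomTail n M (ε k) ≤ β := by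
  have hne : {t : ℕ∞ | ∃ N : ℕ, t = N ∧ ∑ k, ∑ i ∈ Finset.range n,
      (N.choose i : ℝ) * ε k ^ i * (1 - ε k) ^ (N - i) ≤ β}.Nonempty := by
    by_contra hcon
    rw [Set.not_nonempty_iff_eq_empty] at hcon
    rw [sampleBound, hcon, sInf_empty] at h
    exact absurd h (by simp)
  obtain ⟨M, hM, hβ⟩ := csInf_mem hne
  refine ⟨M, ?_, hβ⟩
  rw [sampleBound, hM] at h
  exact_mod_cast h

end

/-! ### Assembly over the subprograms. -/

theorem theorem4p3 {n m : ℕ} (hm : 0 < m)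
    {D : Type*} [MetricSpace D] [MeasurableSpace D] [BorelSpace D]
    (P : Measure D) [IsProbabilityMeasure P]
    (c : EuclideanSpace ℝ (Fin n)) (Q : Fin m → UncertainProgram n D)
    (hopt : ∀ k, (Q k).HasMeasurableOptimizer c)
    (x₀ : Fin m → EuclideanSpace ℝ (Fin n)) (hx₀ : ∀ k, (Q k).IsSlater (x₀ k))
    (h : Fin m → ℝ → ℝ≥0∞) (hh : ∀ k, (Q k).IsULB P (h k))
    (ε : Fin m → ℝ) (hε : ∀ k, ε k ∈ Set.Icc (0 : ℝ) 1)
    (β : ℝ) (hβ : β ∈ Set.Icc (0 : ℝ) 1)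
    (N : ℕ) (hN : sampleBound n ε β ≤ (N : ℕ∞)) :
    HoldsWithProb (Measure.pi fun _ : Fin N => P) (1 - β)
      {d | optValue c (⋃ k, (Q k).robust) - optValue c (⋃ k, (Q k).scenario d) ∈
        Set.Icc 0 (⨆ k, (Q k).aPriori c (x₀ k) (h k) (ε k))} ∧
    HoldsWithProb (Measure.pi fun _ : Fin N => P) (1 - β)
      {d | optValue c (⋃ k, (Q k).chance P (ε k)) - optValue c (⋃ k, (Q k).scenario d) ∈
        Set.Icc (-(⨆ k, (Q k).aPriori c (x₀ k) (h k) (ε k))) 0} ∧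
    ∀ lam : Fin m → (Fin N → D) → Fin N → ℝ,
      (∀ k d, (Q k).IsDualOptimizer c d (lam k d)) →
      HoldsWithProb (Measure.pi fun _ : Fin N => P) (1 - β)
        {d | optValue c (⋃ k, (Q k).chance P (ε k)) - optValue c (⋃ k, (Q k).scenario d) ∈
          Set.Icc (-(⨆ k, (Q k).aPosteriori c (lam k d) (h k) (ε k))) 0} := by
  -- The intersection of these measurable events serves all three claims; no measurability of the
  -- dual optimizers is involved.
  let S : Fin m → Set (Fin N → D) := fun k =>
    {d | optValue c ((Q k).chance P (ε k)) ≤ optValue c ((Q k).scenario d)}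
  have hSm : ∀ k, MeasurableSet (S k) := fun k => measurableSet_le measurable_const
    (UncertainProgram.measurable_optValue_scenario (hopt k) N)
  have hAm : MeasurableSet (⋂ k, S k) := MeasurableSet.iInter hSm
  have hAP : 1 - β ≤ (Measure.pi fun _ : Fin N => P).real (⋂ k, S k) := by
    obtain ⟨M, hMN, hM⟩ := exists_le_of_sampleBound_le hN
    have h1 : (Measure.pi fun _ : Fin N => P).real (⋂ k, S k)ᶜ ≤ β := by
      rw [Set.compl_iInter]
      refine (measureReal_iUnion_fintype_le _).trans ((Finset.sum_le_sum fun k _ => ?_).trans hM)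
      rw [probReal_compl_eq_one_sub (hSm k)]
      have h2 := UncertainProgram.le_measureReal_optValue_le (P := P) (hopt k) (hx₀ k) (hε k) N
      -- The inequality with β is known only at some M ≤ N; the tails decrease in the sample size.
      have h3 := binomTail_anti (hε k) n hMN
      simp only at h3
      linarith
    rw [probReal_compl_eq_one_sub hAm] at h1
    linarith
  have hbdd : ∀ T : Fin m → Set (EuclideanSpace ℝ (Fin n)), (∀ k, T k ⊆ (Q k).X) →
      BddBelow ((fun x => inner ℝ c x) '' ⋃ k, T k) := fun T hT =>
    ((isCompact_iUnion fun k => (Q k).isCompact_X).image (by fun_prop)).bddBelow.mono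
      (Set.image_mono (Set.iUnion_mono hT))
  have hbR := hbdd (fun k => (Q k).robust) fun k _ hx => hx.1
  have hbC := hbdd (fun k => (Q k).chance P (ε k)) fun k _ hx => hx.1
  have hbS := fun d : Fin N → D => hbdd (fun k => (Q k).scenario d) fun k _ hx => hx.1
  have hrob : ∀ k, x₀ k ∈ (Q k).robust := fun k => (hx₀ k).mem_robust
  have hneR : (⋃ k, (Q k).robust).Nonempty := ⟨x₀ ⟨0, hm⟩, Set.mem_iUnion.2 ⟨_, hrob _⟩⟩
  have hRC : ∀ k, (Q k).robust ⊆ (Q k).chance P (ε k) := fun k =>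
    (Q k).robust_subset_chance (hε k).1
  have hneC : (⋃ k, (Q k).chance P (ε k)).Nonempty := hneR.mono (Set.iUnion_mono hRC)
  have hSR : ∀ d : Fin N → D,
      optValue c (⋃ k, (Q k).scenario d) ≤ optValue c (⋃ k, (Q k).robust) := fun d =>
    optValue_anti (hbS d) hneR (Set.iUnion_mono fun k => (Q k).robust_subset_scenario d)
  have hCS : ∀ d ∈ ⋂ k, S k,
      optValue c (⋃ k, (Q k).chance P (ε k)) ≤ optValue c (⋃ k, (Q k).scenario d) := fun d hd => by
    refine le_optValue (hneR.mono (Set.iUnion_mono fun k => (Q k).robust_subset_scenario d))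
      fun x hx => ?_
    obtain ⟨k, hk⟩ := Set.mem_iUnion.1 hx
    calc optValue c (⋃ k, (Q k).chance P (ε k)) ≤ optValue c ((Q k).chance P (ε k)) :=
          optValue_anti hbC ⟨_, hRC k (hrob k)⟩ (Set.subset_iUnion (fun k => (Q k).chance P (ε k)) k)
      _ ≤ optValue c ((Q k).scenario d) := Set.mem_iInter.1 hd k
      _ ≤ inner ℝ c x := optValue_le ((Q k).bddBelow_image_inner c fun _ h => h.1) hk
  have hRC' : optValue c (⋃ k, (Q k).robust) - (⨆ k, (Q k).aPriori c (x₀ k) (h k) (ε k)) ≤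
      optValue c (⋃ k, (Q k).chance P (ε k)) := by
    refine le_optValue hneC fun x hx => ?_
    obtain ⟨k, hk⟩ := Set.mem_iUnion.1 hx
    have h1 : optValue c (⋃ k, (Q k).robust) ≤ optValue c (Q k).robust :=
      optValue_anti hbR ⟨_, hrob k⟩ (Set.subset_iUnion (fun k => (Q k).robust) k)
    have h2 := UncertainProgram.optValue_robust_le_of_mem_chance (hx₀ k) (hh k) (hε k) hk (c := c)
    have h3 := le_ciSup (f := fun k => (Q k).aPriori c (x₀ k) (h k) (ε k))
      (Set.finite_range _).bddAbove k
    linarith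
  refine ⟨⟨_, hAm, fun d hd => ⟨?_, ?_⟩, hAP⟩, ⟨_, hAm, fun d hd => ⟨?_, ?_⟩, hAP⟩,
    fun lam hlam => ⟨_, hAm, fun d hd => ⟨?_, ?_⟩, hAP⟩⟩
  · linarith [hSR d]
  · linarith [hCS d hd]
  · linarith [hSR d]
  · linarith [hCS d hd]
  · have : optValue c (⋃ k, (Q k).scenario d) -
        (⨆ k, (Q k).aPosteriori c (lam k d) (h k) (ε k)) ≤
        optValue c (⋃ k, (Q k).chance P (ε k)) := by
      refine le_optValue hneC fun x hx => ?_
      obtain ⟨k, hk⟩ := Set.mem_iUnion.1 hx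
      have h1 : optValue c (⋃ k, (Q k).scenario d) ≤ optValue c ((Q k).scenario d) :=
        optValue_anti (hbS d) ⟨_, (Q k).robust_subset_scenario d (hrob k)⟩
          (Set.subset_iUnion (fun k => (Q k).scenario d) k)
      have h2 := UncertainProgram.optValue_scenario_le_of_mem_chance (hx₀ k) (hh k) (hε k)
        (hlam k d) hk
      have h3 := le_ciSup (f := fun k => (Q k).aPosteriori c (lam k d) (h k) (ε k))
        (Set.finite_range _).bddAbove k
      linarith
    linarith
  · linarith [hCS d hd]
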